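/- Let $\epsilon>0$, let $B_\epsilon(0)\subset\mathbb C^3$ be the open Euclidean ball, and let $C_\epsilon=\{u=(u^1,u^2,u^3)\in B_\epsilon(0)\mid u^1u^2=(u^3)^2\}$, an $A_1$ singularity at $u=0$. Put $\mathcal K_\epsilon=\{u\in\mathbb C^3\mid 0<\|u\|\le\epsilon,\ u^1u^2=(u^3)^2\}$ and $$W_\epsilon=\{(u,v)\in\mathcal K_\epsilon\times\mathbb P^2\mid u^jv^k=u^kv^j\ \text{for all } j,k\in\{1,2,3\}\},$$ where $v=(v^1:v^2:v^3)$ are homogeneous coordinates. Let $\overline W_\epsilon$ be the closure of $W_\epsilon$ in $\mathbb C^3\times\mathbb P^2$, and let $V_\epsilon$ be the interior of $\overline W_\epsilon$ relative to the closed set $\overline{\bigcup_{\delta>0}W_\delta}\subset\mathbb C^3\times\mathbb P^2$; equivalently, $V_\epsilon=\{(u,v)\in\overline W_\epsilon\mid \|u\|<\epsilon\}$. Let $\sigma\colon V_\epsilon\to C_\epsilon$, $\sigma(u,v)=u$, be the blow-up of the singularity, and let $E=\sigma^{-1}(0)$ be its exceptional divisor. Then: 1. $V_\epsilon$ (with the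 subspace topology) is a two-dimensional complex manifold, embedded as a complex submanifold in $\mathbb C^3\times\mathbb P^2$. 2. $C_\epsilon\setminus\{0\}$ is a two-dimensional complex submanifold of $\mathbb C^3$, and $\sigma$ restricts to a biholomorphic map $V_\epsilon\setminus E\to C_\epsilon\setminus\{0\}$. 3. $E$ is a one-dimensional complex submanifold of $V_\epsilon$, and it is biholomorphic to $\mathbb P^1$. 4. The canonical bundle of $V_\epsilon$ is trivial as a holomorphic line bundle. More precisely, there is a nowhere vanishing holomorphic $2$-form $\eta$ on $V_\epsilon$ whose pullback under the holomorphic map $z\mapsto(\sigma_{|V_\epsilon\setminus E})^{-1}(\mathfrak u(z))$ from $\{z\in\mathbb C^2\setminus\{0\}\mid \|\mathfrak u(z)\|<\epsilon\}$ to $V_\epsilon$ is $dz^1\wedge dz^2$, where $\mathfrak u(z^1,z^2)=((z^1)^2,(z^2)^2,z^1z^2)$. -/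

import Mathlib

open scoped Manifold ContDiff Topology LinearAlgebra.Projectivization

/-! ### Complex projective space as a complex manifold -/

/-- Complex projective `n`-space: the lines through the origin in `ℂ^(n+1)`. -/
abbrev CP (n : ℕ) : Type := ℙ ℂ (Fin (n + 1) → ℂ)

namespace CP

variable {n : ℕ}

/-- The quotient topology of `ℂ^(n+1) \ {0} → ℙⁿ`. -/
instance instTopologicalSpace : TopologicalSpace (CP n) :=
  inferInstanceAs (TopologicalSpace (Quotient (projectivizationSetoid ℂ (Fin (n + 1) → ℂ))))

theorem isQuotientMap_mk' :
    Topology.IsQuotientMap (fun v : {v : Fin (n + 1) → ℂ // v ≠ 0} => (Projectivization.mk' ℂ v : CP n)) :=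
  isQuotientMap_quotient_mk'

theorem rep_mk (v : Fin (n + 1) → ℂ) (hv : v ≠ 0) :
    ∃ a : ℂ, a ≠ 0 ∧ ∀ i, v i = a * (Projectivization.mk ℂ v hv).rep i := by
  obtain ⟨a, ha⟩ := Projectivization.exists_smul_eq_mk_rep ℂ v hv
  refine ⟨(a⁻¹ : ℂˣ), Units.ne_zero _, fun i => ?_⟩
  rw [← ha]
  simp [Units.smul_def]

theorem rep_mk_eq_zero_iff (v : Fin (n + 1) → ℂ) (hv : v ≠ 0) (i : Fin (n + 1)) :
    (Projectivization.mk ℂ v hv).rep i = 0 ↔ v i = 0 := by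
  obtain ⟨a, ha, h⟩ := rep_mk v hv
  simp [h i, ha]

/-- The affine coordinates `(v_j / v_i)_{j ≠ i}` of a point of `ℙⁿ`. -/
noncomputable def affineCoord (i : Fin (n + 1)) (v : CP n) : Fin n → ℂ :=
  fun j => v.rep (i.succAbove j) / v.rep i

theorem affineCoord_mk (i : Fin (n + 1)) (v : Fin (n + 1) → ℂ) (hv : v ≠ 0) :
    affineCoord i (Projectivization.mk ℂ v hv) = fun j => v (i.succAbove j) / v i := by
  obtain ⟨a, ha, h⟩ := rep_mk v hv
  funext j
  rw [h, h, mul_div_mul_left _ _ ha]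
  rfl

theorem insertNth_ne_zero (i : Fin (n + 1)) (w : Fin n → ℂ) :
    (i.insertNth (1 : ℂ) w : Fin (n + 1) → ℂ) ≠ 0 := fun h => by
  have := congrFun h i
  simp at this

/-- The point of `ℙⁿ` with homogeneous coordinates `w`, with `1` inserted in the `i`-th place. -/
noncomputable def ofAffine (i : Fin (n + 1)) (w : Fin n → ℂ) : CP n :=
  Projectivization.mk ℂ (i.insertNth (1 : ℂ) w) (insertNth_ne_zero i w)

theorem continuous_ofAffine (i : Fin (n + 1)) : Continuous (ofAffine (n := n) i) := by
  have h : Continuous fun w : Fin n → ℂ =>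
      (⟨i.insertNth (1 : ℂ) w, insertNth_ne_zero i w⟩ : {v : Fin (n + 1) → ℂ // v ≠ 0}) := by
    refine Continuous.subtype_mk ?_ _
    exact continuous_const.finInsertNth i continuous_id
  exact isQuotientMap_mk'.continuous.comp h

theorem isOpen_rep_ne_zero (i : Fin (n + 1)) : IsOpen {v : CP n | v.rep i ≠ 0} := by
  rw [← isQuotientMap_mk'.isOpen_preimage]
  have : (fun v : {v : Fin (n + 1) → ℂ // v ≠ 0} => (Projectivization.mk' ℂ v : CP n)) ⁻¹'
      {v : CP n | v.rep i ≠ 0} = {v | v.1 i ≠ 0} := by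
    ext v
    exact not_congr (rep_mk_eq_zero_iff v.1 v.2 i)
  rw [this]
  exact isOpen_ne_fun ((continuous_apply i).comp continuous_subtype_val) continuous_const

theorem continuousOn_affineCoord (i : Fin (n + 1)) :
    ContinuousOn (affineCoord i) {v : CP n | v.rep i ≠ 0} := by
  refine ((isQuotientMap_mk' (n := n)).continuousOn_isOpen_iff (g := affineCoord i)
    (isOpen_rep_ne_zero i)).2 ?_
  have h : ContinuousOn (fun v : {v : Fin (n + 1) → ℂ // v ≠ 0} =>
      fun j => v.1 (i.succAbove j) / v.1 i) {v | v.1 i ≠ 0} := by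
    refine continuousOn_pi.2 fun j => ContinuousOn.div ?_ ?_ fun v hv => hv
    · exact ((continuous_apply _).comp continuous_subtype_val).continuousOn
    · exact ((continuous_apply _).comp continuous_subtype_val).continuousOn
  refine (h.mono ?_).congr ?_
  · intro v hv
    exact fun h0 => hv ((rep_mk_eq_zero_iff v.1 v.2 i).2 h0)
  · intro v _
    exact affineCoord_mk i v.1 v.2

/-- The standard affine chart `v ↦ (v_j / v_i)_{j ≠ i}` on `{v_i ≠ 0}`. -/
noncomputable def affineChart (i : Fin (n + 1)) : OpenPartialHomeomorph (CP n) (Fin n → ℂ) where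
  toFun := affineCoord i
  invFun := ofAffine i
  source := {v | v.rep i ≠ 0}
  target := Set.univ
  map_source' _ _ := Set.mem_univ _
  map_target' w _ := by
    have h := rep_mk_eq_zero_iff (i.insertNth (1 : ℂ) w) (insertNth_ne_zero i w) i
    exact fun h0 => by simpa using h.1 h0
  left_inv' v hv := by
    change v.rep i ≠ 0 at hv
    conv_rhs => rw [← v.mk_rep]
    refine (Projectivization.mk_eq_mk_iff' ℂ _ _ _ _).2 ⟨(v.rep i)⁻¹, ?_⟩
    funext k
    refine Fin.succAboveCases i ?_ (fun j => ?_) k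
    · simp [hv]
    · simp [affineCoord, div_eq_inv_mul]
  right_inv' w _ := by
    rw [ofAffine, affineCoord_mk]
    simp
  open_source := isOpen_rep_ne_zero i
  open_target := isOpen_univ
  continuousOn_toFun := continuousOn_affineCoord i
  continuousOn_invFun := (continuous_ofAffine i).continuousOn

theorem exists_rep_ne_zero (v : CP n) : ∃ i, v.rep i ≠ 0 := by
  by_contra! h
  exact v.rep_nonzero (funext h)

noncomputable instance instChartedSpace : ChartedSpace (Fin n → ℂ) (CP n) where
  atlas := Set.range affineChart
  chartAt v := affineChart (exists_rep_ne_zero v).choose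
  mem_chart_source v := (exists_rep_ne_zero v).choose_spec
  chart_mem_atlas _ := Set.mem_range_self _

instance instIsManifold : IsManifold 𝓘(ℂ, Fin n → ℂ) ω (CP n) := by
  refine isManifold_of_contDiffOn _ _ _ ?_
  rintro _ _ ⟨i, rfl⟩ ⟨j, rfl⟩
  have key : ∀ k, ContDiff ℂ ω fun w : Fin n → ℂ => (i.insertNth (1 : ℂ) w : Fin (n + 1) → ℂ) k := by
    intro k
    refine Fin.succAboveCases i ?_ (fun l => ?_) k
    · simpa using contDiff_const
    · simpa using contDiff_apply ℂ ℂ l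
  have h : ContDiffOn ℂ ω (fun w : Fin n → ℂ => fun k =>
      (i.insertNth (1 : ℂ) w : Fin (n + 1) → ℂ) (j.succAbove k) /
        (i.insertNth (1 : ℂ) w : Fin (n + 1) → ℂ) j)
      {w | (i.insertNth (1 : ℂ) w : Fin (n + 1) → ℂ) j ≠ 0} :=
    contDiffOn_pi.2 fun k => (key _).contDiffOn.div (key j).contDiffOn fun w hw => hw
  refine (h.mono ?_).congr ?_
  · rintro w ⟨hw, -⟩
    have hw' : (ofAffine i w).rep j ≠ 0 := hw.2
    exact fun h0 => hw' ((rep_mk_eq_zero_iff _ _ j).2 h0)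
  · intro w _
    exact affineCoord_mk j _ _

end CP

/-! ### The canonical bundle of a complex manifold -/

section Canonical

variable (d : ℕ) (M : Type*) [TopologicalSpace M] [ChartedSpace (Fin d → ℂ) M]
  [IsManifold 𝓘(ℂ, Fin d → ℂ) 1 M]

/-- The canonical bundle `K_M = Λ^d (T^{1,0} M)^*` of a complex `d`-manifold `M`. Its fibre at `x`
consists of the alternating `ℂ`-multilinear `d`-forms on the tangent space at `x`; the coordinate
changes are the pullbacks of forms by the coordinate changes of the tangent bundle. -/
noncomputable def canonicalBundleCore :
    VectorBundleCore ℂ M ((Fin d → ℂ) [⋀^Fin d]→L[ℂ] ℂ) (atlas (Fin d → ℂ) M) where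
  baseSet i := i.1.source
  isOpen_baseSet i := i.1.open_source
  indexAt := achart (Fin d → ℂ)
  mem_baseSet_at := mem_chart_source (Fin d → ℂ)
  coordChange i j x := ContinuousAlternatingMap.compContinuousLinearMapCLM
    ((tangentBundleCore 𝓘(ℂ, Fin d → ℂ) M).coordChange j i x)
  coordChange_self i x hx η := by
    ext v
    have h := (tangentBundleCore 𝓘(ℂ, Fin d → ℂ) M).coordChange_self i x hx
    exact congrArg η (funext fun a => h (v a))
  continuousOn_coordChange i j := by
    refine ContinuousAlternatingMap.continuous_compContinuousLinearMapCLM.comp_continuousOn ?_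
    rw [Set.inter_comm]
    exact (tangentBundleCore 𝓘(ℂ, Fin d → ℂ) M).continuousOn_coordChange j i
  coordChange_comp i j k x hx η := by
    ext v
    have h := (tangentBundleCore 𝓘(ℂ, Fin d → ℂ) M).coordChange_comp k j i x
      ⟨⟨hx.2, hx.1.2⟩, hx.1.1⟩
    exact congrArg η (funext fun a => h (v a))

/-- The total space of the canonical bundle. -/
abbrev CanonicalBundle : Type _ := (canonicalBundleCore d M).TotalSpace

/-- The fibre at `x` of the canonical bundle. -/
abbrev CanonicalFiber (x : M) : Type := (canonicalBundleCore d M).Fiber x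

variable {d M}

/-- The value of an element of the fibre of the canonical bundle at `x` on `d` tangent vectors. -/
noncomputable def CanonicalFiber.eval {x : M} (η : CanonicalFiber d M x)
    (v : Fin d → TangentSpace 𝓘(ℂ, Fin d → ℂ) x) : ℂ :=
  (show (Fin d → ℂ) [⋀^Fin d]→L[ℂ] ℂ from η) v

/-- A family of `d`-forms on the tangent spaces is a holomorphic section of the canonical
bundle. -/
def IsHolomorphicTopForm (η : ∀ x : M, CanonicalFiber d M x) : Prop :=
  ContMDiff 𝓘(ℂ, Fin d → ℂ)
    (𝓘(ℂ, Fin d → ℂ).prod 𝓘(ℂ, (Fin d → ℂ) [⋀^Fin d]→L[ℂ] ℂ)) ω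
    (fun x => (⟨x, η x⟩ : CanonicalBundle d M))

variable (d M)

/-- The canonical bundle is trivial: it is isomorphic to `M × ℂ` as a holomorphic line bundle,
that is, by a biholomorphic map of total spaces over `M` which is linear on the fibres. -/
def HasTrivialCanonicalBundle : Prop :=
  ∃ Φ : CanonicalBundle d M
      ≃ₘ^ω⟮𝓘(ℂ, Fin d → ℂ).prod 𝓘(ℂ, (Fin d → ℂ) [⋀^Fin d]→L[ℂ] ℂ),
        𝓘(ℂ, Fin d → ℂ).prod 𝓘(ℂ, ℂ)⟯ (M × ℂ),
    (∀ p, (Φ p).1 = p.proj) ∧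
      ∀ x : M, IsLinearMap ℂ fun η : CanonicalFiber d M x => (Φ ⟨x, η⟩).2

end Canonical

/-! ### The blow-up of the `A₁` singularity -/

namespace AOne

/-- `ℂ³` with the Euclidean norm. -/
abbrev C3 : Type := EuclideanSpace ℂ (Fin 3)

/-- The map `𝔲(z¹, z²) = ((z¹)², (z²)², z¹ z²)`. -/
noncomputable def frakU (z : Fin 2 → ℂ) : C3 := !₂[z 0 ^ 2, z 1 ^ 2, z 0 * z 1]

/-- The cone `𝔲(U_ε) = {u ∈ B_ε(0) | u¹ u² = (u³)²}`. -/
def cone (ε : ℝ) : Set C3 := {u | u ∈ Metric.ball 0 ε ∧ u 0 * u 1 = u 2 ^ 2}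

/-- The punctured cone `𝔲(U_ε) \ {0}`. -/
def puncturedCone (ε : ℝ) : Set C3 := cone ε \ {0}

/-- The punctured closed cone `𝒦_ε`. -/
def closedPuncturedCone (ε : ℝ) : Set C3 :=
  {u | u ∈ Metric.closedBall 0 ε ∧ u 0 * u 1 = u 2 ^ 2} \ {0}

/-- The incidence relation `u^j v^k = u^k v^j` for all `j, k`; being homogeneous in `v`, it can be
tested on any vector of homogeneous coordinates. -/
def Incident (u : C3) (v : CP 2) : Prop := ∀ j k : Fin 3, u j * v.rep k = u k * v.rep j

/-- `W_ε = {(u, v) ∈ 𝒦_ε × ℙ² | u^j v^k = u^k v^j}`. -/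
def W (ε : ℝ) : Set (C3 × CP 2) := {p | p.1 ∈ closedPuncturedCone ε ∧ Incident p.1 p.2}

/-- The blow-up of the whole cone: the closure of the union of all `W_δ`, a surface in `ℂ³ × ℙ²`. -/
def totalBlowup : Set (C3 × CP 2) := closure (⋃ δ : ℝ, W δ)

/-- `V_ε`: the interior of the closure of `W_ε`, taken relative to the surface which contains it
(relative to `ℂ³ × ℙ²` the interior would be empty). -/
def V (ε : ℝ) : Set (C3 × CP 2) := {p | p ∈ closure (W ε) ∧ closure (W ε) ∈ 𝓝[totalBlowup] p}

theorem norm_le_of_mem_closure_W {ε : ℝ} {p : C3 × CP 2} (hp : p ∈ closure (W ε)) : ‖p.1‖ ≤ ε := by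
  have hcl : IsClosed {q : C3 × CP 2 | ‖q.1‖ ≤ ε} :=
    isClosed_le (continuous_norm.comp continuous_fst) continuous_const
  exact closure_minimal (fun q hq => by simpa using hq.1.1.1) hcl hp

theorem eq_of_mem_closure_W {ε : ℝ} {p : C3 × CP 2} (hp : p ∈ closure (W ε)) :
    p.1 0 * p.1 1 = p.1 2 ^ 2 := by
  have hcl : IsClosed {q : C3 × CP 2 | q.1 0 * q.1 1 = q.1 2 ^ 2} :=
    isClosed_eq (by fun_prop) (by fun_prop)
  exact closure_minimal (fun q hq => hq.1.1.2) hcl hp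

theorem smul_mem_W {ε : ℝ} {p : C3 × CP 2} (hp : p ∈ W ε) {t : ℝ} (ht : 0 < t) :
    ((t : ℂ) • p.1, p.2) ∈ W (t * ε) := by
  obtain ⟨⟨⟨hb, he⟩, h0⟩, hi⟩ := hp
  have ht' : (t : ℂ) ≠ 0 := by exact_mod_cast ht.ne'
  refine ⟨⟨⟨?_, ?_⟩, ?_⟩, fun j k => ?_⟩
  · rw [mem_closedBall_zero_iff] at hb ⊢
    rw [norm_smul, Complex.norm_real, Real.norm_of_nonneg ht.le]
    exact mul_le_mul_of_nonneg_left hb ht.le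
  · simp only [PiLp.smul_apply, smul_eq_mul]
    linear_combination (t : ℂ) ^ 2 * he
  · exact fun h => h0 ((smul_eq_zero.1 h).resolve_left ht')
  · simp only [PiLp.smul_apply, smul_eq_mul]
    linear_combination (t : ℂ) * hi j k

theorem smul_mem_totalBlowup {ε : ℝ} {p : C3 × CP 2} (hp : p ∈ closure (W ε)) {t : ℝ}
    (ht : 0 < t) : ((t : ℂ) • p.1, p.2) ∈ totalBlowup := by
  have hc : Continuous fun q : C3 × CP 2 => ((t : ℂ) • q.1, q.2) := by fun_prop
  have h : ((t : ℂ) • p.1, p.2) ∈ closure (W (t * ε)) :=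
    map_mem_closure (f := fun q : C3 × CP 2 => ((t : ℂ) • q.1, q.2)) hc hp
      fun q hq => smul_mem_W hq ht
  exact closure_mono (Set.subset_iUnion W (t * ε)) h

/-- `V_ε` is the part of the closure of `W_ε` over the open ball. -/
theorem mem_V_iff {ε : ℝ} (hε : 0 < ε) {p : C3 × CP 2} :
    p ∈ V ε ↔ p ∈ closure (W ε) ∧ p.1 ∈ Metric.ball 0 ε := by
  rw [mem_ball_zero_iff]
  constructor
  · rintro ⟨hp, hn⟩
    refine ⟨hp, (norm_le_of_mem_closure_W hp).lt_of_ne fun heq => ?_⟩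
    have hcont : Filter.Tendsto (fun t : ℝ => ((t : ℂ) • p.1, p.2)) (𝓝[>] 1)
        (𝓝[totalBlowup] p) := by
      refine tendsto_nhdsWithin_iff.2 ⟨?_, ?_⟩
      · have hc : Continuous fun t : ℝ => ((t : ℂ) • p.1, p.2) := by fun_prop
        have := hc.tendsto 1
        simp only [Complex.ofReal_one, one_smul] at this
        exact this.mono_left nhdsWithin_le_nhds
      · filter_upwards [self_mem_nhdsWithin] with t ht
        exact smul_mem_totalBlowup hp (zero_lt_one.trans ht)
    obtain ⟨t, ht, ht1⟩ := ((hcont.eventually hn).and self_mem_nhdsWithin).exists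
    have h1 : (1 : ℝ) < t := ht1
    have h2 := norm_le_of_mem_closure_W ht
    simp only [norm_smul, Complex.norm_real, heq] at h2
    rw [Real.norm_of_nonneg (by linarith)] at h2
    nlinarith
  · rintro ⟨hp, hn⟩
    refine ⟨hp, ?_⟩
    have ho : IsOpen {q : C3 × CP 2 | ‖q.1‖ < ε} :=
      isOpen_lt (continuous_norm.comp continuous_fst) continuous_const
    filter_upwards [self_mem_nhdsWithin, mem_nhdsWithin_of_mem_nhds (ho.mem_nhds hn)] with q hq hqn
    refine closure_mono ?_ (ho.inter_closure ⟨hqn, hq⟩)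
    rintro r ⟨hr, hrW⟩
    obtain ⟨δ, hδ⟩ := Set.mem_iUnion.1 hrW
    exact ⟨⟨⟨by simpa using (le_of_lt hr : ‖r.1‖ ≤ ε), hδ.1.1.2⟩, hδ.1.2⟩, hδ.2⟩

theorem fst_mem_cone {ε : ℝ} (hε : 0 < ε) {p : C3 × CP 2} (hp : p ∈ V ε) : p.1 ∈ cone ε :=
  ⟨((mem_V_iff hε).1 hp).2, eq_of_mem_closure_W hp.1⟩

/-- The blow-up map `σ : V_ε → 𝔲(U_ε)`, `σ(u, v) = u`. -/
def sigma {ε : ℝ} (hε : 0 < ε) (p : V ε) : cone ε := ⟨p.1.1, fst_mem_cone hε p.2⟩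

/-- The exceptional divisor `E = σ⁻¹(0) ⊆ V_ε`. -/
def E {ε : ℝ} (hε : 0 < ε) : Set (V ε) := {p | (sigma hε p : C3) = 0}

theorem isClosed_E {ε : ℝ} (hε : 0 < ε) : IsClosed (E hε) :=
  isClosed_eq (continuous_fst.comp continuous_subtype_val) continuous_const

/-- `V_ε \ E`, as an open subset of `V_ε`. -/
def complE {ε : ℝ} (hε : 0 < ε) : TopologicalSpace.Opens (V ε) :=
  ⟨(E hε)ᶜ, (isClosed_E hε).isOpen_compl⟩

theorem continuous_frakU : Continuous frakU := by
  refine (PiLp.continuous_toLp 2 _).comp (continuous_pi fun i => ?_)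
  fin_cases i <;> simp <;> fun_prop

/-- The open set of those `z ≠ 0` in `ℂ²` with `𝔲(z) ∈ B_ε(0)`. -/
def puncturedDomain (ε : ℝ) : TopologicalSpace.Opens (Fin 2 → ℂ) :=
  ⟨{z | z ≠ 0 ∧ frakU z ∈ Metric.ball 0 ε},
    (isOpen_ne).inter (Metric.isOpen_ball.preimage continuous_frakU)⟩

theorem frakU_mem_puncturedCone {ε : ℝ} (z : puncturedDomain ε) :
    frakU z.1 ∈ puncturedCone ε := by
  refine ⟨⟨z.2.2, ?_⟩, fun h => z.2.1 ?_⟩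
  · simp [frakU]
    ring
  · have h0 := congrArg (fun u : C3 => u 0) h
    have h1 := congrArg (fun u : C3 => u 1) h
    simp [frakU] at h0 h1
    funext i
    fin_cases i
    · exact h0
    · exact h1

/-- The restriction of `𝔲` to a map onto the punctured cone. -/
noncomputable def frakURestrict (ε : ℝ) (z : puncturedDomain ε) : puncturedCone ε :=
  ⟨frakU z.1, frakU_mem_puncturedCone z⟩

end AOne

/-! Let `Q` be the conic `v¹v² = (v³)²` in `ℙ²`. If `u ≠ 0` lies on the cone, incidence forces `v`
to be the line through `u`, a point of `Q`; conversely `(0, v)` with `v ∈ Q` is the limit of `(s v,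
v)` as `s → 0`. Hence `V_ε` consists of all pairs with `v ∈ Q`, `u` on the line `v` and `‖u‖ < ε`
(`mem_V_iff_incident`): it is a neighbourhood of the zero section in the tautological line bundle
over `Q`. Since `Q` is the Veronese image of `ℙ¹`, this bundle is `O(-2)`, and its zero section is
`E`.

Two affine lines with points `(1 : t² : t)` and `(t² : 1 : t)` cover `Q`. With the scalar `s = u^i`
they give coordinates in which `V_ε` is locally a graph in `ℂ³ × ℙ²`. The cone away from `0`, and
`E` inside `V_ε`, are local graphs too, so one construction, `GraphAtlas`, supplies all three
complex structures and embeddings. Off `E` the inverse of `σ` is `u ↦ (u, [u])`, which is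
holomorphic because its homogeneous coordinates are.

The change of charts `(s, t) ↦ (1/t, s t²)` has Jacobian determinant `1` (`isUnimodularAtlas_V`).
Constant 2-forms in the charts therefore glue and trivialize the canonical bundle. The lift of `𝔲`
reads `z ↦ (z_i², z_{i+1}/z_i)`, with determinant `2`, so half of the standard form pulls back to
`dz¹ ∧ dz²`. -/

/-! ### Submanifolds that are locally graphs -/

section Graph

open Manifold

variable {𝕜 : Type*} [NontriviallyNormedField 𝕜]
  {E : Type*} [NormedAddCommGroup E] [NormedSpace 𝕜 E]
  {E' : Type*} [NormedAddCommGroup E'] [NormedSpace 𝕜 E']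
  {N : Type*} [TopologicalSpace N] [ChartedSpace E' N]

variable (𝕜 E E') in
/-- A chart `ambient` of `N` in which the subset `S` is the graph of a `C^n` map: the part of `S`
over `dom` is parametrized by `param`, which is a section of the linear projection `proj`. -/
structure GraphChart (n : ℕ∞ω) (S : Set N) where
  ambient : OpenPartialHomeomorph N E'
  ambient_mem : ambient ∈ IsManifold.maximalAtlas 𝓘(𝕜, E') n N
  proj : E' →L[𝕜] E
  dom : Set E
  isOpen_dom : IsOpen dom
  param : E → E'
  contDiffOn_param : ContDiffOn 𝕜 n param dom
  proj_param : ∀ x ∈ dom, proj (param x) = x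
  param_mem : ∀ x ∈ dom, param x ∈ ambient.target
  symm_param_mem : ∀ x ∈ dom, ambient.symm (param x) ∈ S
  param_proj : ∀ y ∈ S, y ∈ ambient.source → proj (ambient y) ∈ dom →
    param (proj (ambient y)) = ambient y

namespace GraphChart

variable {n : ℕ∞ω} {S : Set N}

open Classical in
/-- The inverse of the chart of `S` given by a graph chart. -/
noncomputable def invFun [Nonempty S] (c : GraphChart 𝕜 E E' n S) (x : E) : S :=
  if h : x ∈ c.dom then ⟨c.ambient.symm (c.param x), c.symm_param_mem x h⟩ else Classical.arbitrary S

theorem coe_invFun [Nonempty S] (c : GraphChart 𝕜 E E' n S) {x : E} (hx : x ∈ c.dom) :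
    (c.invFun x : N) = c.ambient.symm (c.param x) := by
  rw [invFun, dif_pos hx]

/-- The chart of `S` given by a graph chart. -/
noncomputable def chart [Nonempty S] (c : GraphChart 𝕜 E E' n S) : OpenPartialHomeomorph S E where
  toFun y := c.proj (c.ambient y)
  invFun := c.invFun
  source := {y | (y : N) ∈ c.ambient.source ∧ c.proj (c.ambient y) ∈ c.dom}
  target := c.dom
  map_source' _ hy := hy.2
  map_target' x hx := by
    change _ ∧ _
    rw [c.coe_invFun hx, c.ambient.right_inv (c.param_mem x hx), c.proj_param x hx]
    exact ⟨c.ambient.map_target (c.param_mem x hx), hx⟩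
  left_inv' y hy := by
    refine Subtype.ext ?_
    rw [c.coe_invFun hy.2, c.param_proj _ y.2 hy.1 hy.2, c.ambient.left_inv hy.1]
  right_inv' x hx := by
    rw [c.coe_invFun hx, c.ambient.right_inv (c.param_mem x hx), c.proj_param x hx]
  open_source := by
    have h := (c.proj.continuous.comp_continuousOn c.ambient.continuousOn).isOpen_inter_preimage
      c.ambient.open_source c.isOpen_dom
    exact h.preimage continuous_subtype_val
  open_target := c.isOpen_dom
  continuousOn_toFun :=
    (c.proj.continuous.comp_continuousOn c.ambient.continuousOn).comp
      continuous_subtype_val.continuousOn fun _ hy => hy.1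
  continuousOn_invFun := by
    rw [Topology.IsEmbedding.subtypeVal.continuousOn_iff]
    exact (c.ambient.continuousOn_symm.comp c.contDiffOn_param.continuousOn c.param_mem).congr
      fun x hx => c.coe_invFun hx

theorem chart_apply [Nonempty S] (c : GraphChart 𝕜 E E' n S) (y : S) :
    c.chart y = c.proj (c.ambient y) := rfl

theorem chart_target [Nonempty S] (c : GraphChart 𝕜 E E' n S) : c.chart.target = c.dom := rfl

theorem coe_chart_symm [Nonempty S] (c : GraphChart 𝕜 E E' n S) {x : E} (hx : x ∈ c.dom) :
    (c.chart.symm x : N) = c.ambient.symm (c.param x) := c.coe_invFun hx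

/-- The shear of the ambient model space which straightens a graph. -/
noncomputable def shear (c : GraphChart 𝕜 E E' n S) {F : Type*} [NormedAddCommGroup F]
    [NormedSpace 𝕜 F] (e : (E × F) ≃L[𝕜] E') (he : ∀ y, (e.symm y).1 = c.proj y) :
    OpenPartialHomeomorph E' E' where
  -- A translation along each fibre of `proj`. It fixes `proj y`, so the opposite translation
  -- inverts it, and it carries `param x` to `e (x, 0)`.
  toFun y := y - c.param (c.proj y) + e (c.proj y, 0)
  invFun y := y + c.param (c.proj y) - e (c.proj y, 0)
  source := c.proj ⁻¹' c.dom
  target := c.proj ⁻¹' c.dom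
  map_source' y hy := by
    have h : c.proj (e (c.proj y, 0)) = c.proj y := by simp [← he]
    simpa [h, c.proj_param _ hy] using hy
  map_target' y hy := by
    have h : c.proj (e (c.proj y, 0)) = c.proj y := by simp [← he]
    simpa [h, c.proj_param _ hy] using hy
  left_inv' y hy := by
    have h : c.proj (e (c.proj y, 0)) = c.proj y := by simp [← he]
    simp only [map_add, map_sub, h, c.proj_param _ hy, sub_self, zero_add]
    abel
  right_inv' y hy := by
    have h : c.proj (e (c.proj y, 0)) = c.proj y := by simp [← he]
    simp only [map_add, map_sub, h, c.proj_param _ hy, add_sub_cancel_right]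
    abel
  open_source := c.isOpen_dom.preimage c.proj.continuous
  open_target := c.isOpen_dom.preimage c.proj.continuous
  continuousOn_toFun := by
    have h := c.contDiffOn_param.continuousOn.comp c.proj.continuous.continuousOn
      (Set.mapsTo_preimage c.proj c.dom)
    exact (continuousOn_id.sub h).add (by fun_prop)
  continuousOn_invFun := by
    have h := c.contDiffOn_param.continuousOn.comp c.proj.continuous.continuousOn
      (Set.mapsTo_preimage c.proj c.dom)
    exact (continuousOn_id.add h).sub (by fun_prop)

theorem shear_mem (c : GraphChart 𝕜 E E' n S) {F : Type*} [NormedAddCommGroup F]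
    [NormedSpace 𝕜 F] (e : (E × F) ≃L[𝕜] E') (he : ∀ y, (e.symm y).1 = c.proj y) :
    c.shear e he ∈ contDiffGroupoid n 𝓘(𝕜, E') := by
  have h := c.contDiffOn_param.comp c.proj.contDiff.contDiffOn (Set.mapsTo_preimage c.proj c.dom)
  have h' : ContDiff 𝕜 n fun y => e (c.proj y, 0) :=
    e.contDiff.comp (c.proj.contDiff.prodMk contDiff_const)
  rw [contDiffGroupoid, mem_groupoid_of_pregroupoid]
  constructor
  · simpa [contDiffPregroupoid] using show ContDiffOn 𝕜 n (c.shear e he) (c.shear e he).source from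
      (contDiffOn_id.sub h).add h'.contDiffOn
  · simpa [contDiffPregroupoid] using
      show ContDiffOn 𝕜 n (c.shear e he).symm (c.shear e he).target from
        (contDiffOn_id.add h).sub h'.contDiffOn

end GraphChart

/-- A surjective continuous linear map of finite-dimensional spaces is the first projection in
suitable coordinates. -/
theorem exists_continuousLinearEquiv_fst [CompleteSpace 𝕜] {F : Type*} [NormedAddCommGroup F]
    [NormedSpace 𝕜 F] [FiniteDimensional 𝕜 E] [FiniteDimensional 𝕜 E'] [FiniteDimensional 𝕜 F]
    (r : E' →L[𝕜] E) (hr : Function.Surjective r)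
    (hdim : Module.finrank 𝕜 E' = Module.finrank 𝕜 E + Module.finrank 𝕜 F) :
    ∃ e : (E × F) ≃L[𝕜] E', ∀ y, (e.symm y).1 = r y := by
  have hr' : Function.Surjective r.toLinearMap := hr
  obtain ⟨s, hs⟩ := r.toLinearMap.exists_rightInverse_of_surjective (LinearMap.range_eq_top.2 hr')
  have hk : Module.finrank 𝕜 (LinearMap.ker r.toLinearMap) = Module.finrank 𝕜 F := by
    have := r.toLinearMap.finrank_range_add_finrank_ker
    rw [LinearMap.range_eq_top.2 hr', finrank_top] at this
    omega
  let f : LinearMap.ker r.toLinearMap ≃ₗ[𝕜] F := LinearEquiv.ofFinrankEq _ _ hk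
  have hs' : ∀ x, r (s x) = x := fun x => LinearMap.congr_fun hs x
  let e : (E × F) ≃ₗ[𝕜] E' :=
    { toFun := fun p => s p.1 + f.symm p.2
      map_add' := fun p q => by
        simp only [Prod.fst_add, Prod.snd_add, map_add, Submodule.coe_add]; abel
      map_smul' := fun a p => by simp
      invFun := fun y => (r y, f ⟨y - s (r y), by simp [hs']⟩)
      left_inv := fun p => by
        have h0 : r (f.symm p.2 : E') = 0 := (f.symm p.2).2
        ext
        · simp [hs', h0]
        · simp [hs', h0]
      right_inv := fun y => by simp }
  exact ⟨e.toContinuousLinearEquiv, fun y => rfl⟩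

variable (𝕜 E E') in
/-- A family of graph charts which covers `S`. -/
structure GraphAtlas (n : ℕ∞ω) (S : Set N) (ι : Type*) where
  graph : ι → GraphChart 𝕜 E E' n S
  idx : S → ι
  mem_source : ∀ y : S, (y : N) ∈ (graph (idx y)).ambient.source
  mem_dom : ∀ y : S, (graph (idx y)).proj ((graph (idx y)).ambient y) ∈ (graph (idx y)).dom

namespace GraphAtlas

variable {n : ℕ∞ω} {S : Set N} {ι : Type*} [Nonempty S]

/-- The charts of `S` given by graph charts. -/
@[reducible]
noncomputable def chartedSpace (A : GraphAtlas 𝕜 E E' n S ι) : ChartedSpace E S where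
  atlas := Set.range fun i => (A.graph i).chart
  chartAt y := (A.graph (A.idx y)).chart
  mem_chart_source y := ⟨A.mem_source y, A.mem_dom y⟩
  chart_mem_atlas _ := Set.mem_range_self _

/-- A change of charts is `d.proj` after the ambient change of charts after `c.param`, each of class
`C^n`. -/
theorem isManifold (A : GraphAtlas 𝕜 E E' n S ι) :
    letI := A.chartedSpace
    IsManifold 𝓘(𝕜, E) n S := by
  let _ := A.chartedSpace
  refine isManifold_of_contDiffOn _ _ _ ?_
  rintro _ _ ⟨i, rfl⟩ ⟨j, rfl⟩
  set c := A.graph i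
  set d := A.graph j
  have hcd : ContDiffOn 𝕜 n (c.ambient.symm.trans d.ambient) (c.ambient.symm.trans d.ambient).source := by
    have := (contDiffGroupoid n 𝓘(𝕜, E')).compatible_of_mem_maximalAtlas c.ambient_mem d.ambient_mem
    rw [← contMDiffOn_iff_contDiffOn]
    exact contMDiffOn_of_mem_contDiffGroupoid this
  have hmem : ∀ x ∈ (c.chart.symm.trans d.chart).source,
      x ∈ c.dom ∧ c.ambient.symm (c.param x) ∈ d.ambient.source := by
    intro x hx
    have hx1 : x ∈ c.dom := hx.1
    refine ⟨hx1, ?_⟩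
    rw [← c.coe_chart_symm hx1]
    exact hx.2.1
  have := d.proj.contDiff.comp_contDiffOn (hcd.comp
    (c.contDiffOn_param.mono (t := (c.chart.symm.trans d.chart).source) fun x hx => (hmem x hx).1)
    fun x hx => ⟨c.param_mem x (hmem x hx).1, (hmem x hx).2⟩)
  refine ContDiffOn.congr (f₁ := c.chart.symm.trans d.chart)
    (s := (c.chart.symm.trans d.chart).source) this (fun x hx => ?_) |>.mono ?_
  · simp [d.chart_apply, c.coe_chart_symm (hmem x hx).1]
  · exact fun x hx => hx.1

/-- In the ambient chart followed by the shear, the inclusion becomes `x ↦ e (x, 0)`, which is the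
normal form of an immersion. -/
theorem isImmersionOfComplement [IsManifold 𝓘(𝕜, E') n N] (A : GraphAtlas 𝕜 E E' n S ι) (F : Type*)
    [NormedAddCommGroup F] [NormedSpace 𝕜 F]
    (hF : ∀ i, ∃ e : (E × F) ≃L[𝕜] E', ∀ y, (e.symm y).1 = (A.graph i).proj y) :
    letI := A.chartedSpace
    IsImmersionOfComplement F 𝓘(𝕜, E) 𝓘(𝕜, E') n (Subtype.val : S → N) := by
  let _ := A.chartedSpace
  have := A.isManifold
  intro x
  set c := A.graph (A.idx x)
  obtain ⟨e, he⟩ := hF (A.idx x)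
  refine IsImmersionAtOfComplement.mk_of_charts e c.chart (c.ambient.trans (c.shear e he))
    ⟨A.mem_source x, A.mem_dom x⟩ ⟨A.mem_source x, A.mem_dom x⟩
    (IsManifold.subset_maximalAtlas (Set.mem_range_self _)) ?_ (fun y hy => hy) ?_
  · refine OpenPartialHomeomorph.mem_maximalAtlas_of_contMDiffOn _ ?_ ?_
    · exact (contMDiffOn_of_mem_contDiffGroupoid (c.shear_mem e he)).comp
        ((contMDiffOn_of_mem_maximalAtlas c.ambient_mem).mono fun y hy => hy.1) fun y hy => hy.2
    · exact (contMDiffOn_symm_of_mem_maximalAtlas c.ambient_mem).comp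
        ((contMDiffOn_of_mem_contDiffGroupoid
          ((contDiffGroupoid n 𝓘(𝕜, E')).symm (c.shear_mem e he))).mono fun y hy => hy.1)
        fun y hy => hy.2
  · intro z hz
    have hz : z ∈ c.dom := by simpa [c.chart_target] using hz
    have h1 : c.ambient (c.chart.symm z : N) = c.param z := by
      rw [c.coe_chart_symm hz, c.ambient.right_inv (c.param_mem z hz)]
    simp [h1, GraphChart.shear, c.proj_param z hz]

theorem isSmoothEmbedding [IsManifold 𝓘(𝕜, E') n N] [CompleteSpace 𝕜] [FiniteDimensional 𝕜 E]
    [FiniteDimensional 𝕜 E'] (A : GraphAtlas 𝕜 E E' n S ι)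
    (hsurj : ∀ i, Function.Surjective (A.graph i).proj)
    (k : ℕ) (hk : Module.finrank 𝕜 E' = Module.finrank 𝕜 E + k) :
    letI := A.chartedSpace
    IsSmoothEmbedding 𝓘(𝕜, E) 𝓘(𝕜, E') n (Subtype.val : S → N) := by
  let _ := A.chartedSpace
  refine ⟨(A.isImmersionOfComplement (Fin k → 𝕜) fun i => ?_).isImmersion, .subtypeVal⟩
  exact exists_continuousLinearEquiv_fst _ (hsurj i) (by simpa using hk)

end GraphAtlas

end Graph

/-! ### Topology and smooth maps of complex projective space -/

namespace CP

variable {n : ℕ}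

/-- The saturation of an open set is the union of its translates under `ℂˣ`. -/
theorem isOpenQuotientMap_mk' : IsOpenQuotientMap
    (fun v : {v : Fin (n + 1) → ℂ // v ≠ 0} => (Projectivization.mk' ℂ v : CP n)) := by
  refine IsOpenQuotientMap.iff_isOpenMap_isQuotientMap.2 ⟨fun U hU => ?_, isQuotientMap_mk'⟩
  rw [← isQuotientMap_mk'.isOpen_preimage]
  have h : (fun v : {v : Fin (n + 1) → ℂ // v ≠ 0} => (Projectivization.mk' ℂ v : CP n)) ⁻¹'
      ((fun v => Projectivization.mk' ℂ v) '' U) =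
      ⋃ a : ℂˣ, (fun v => (⟨a • v.1, (smul_ne_zero_iff_ne a).2 v.2⟩ :
        {v : Fin (n + 1) → ℂ // v ≠ 0})) ⁻¹' U := by
    ext v
    simp only [Set.mem_preimage, Set.mem_image, Set.mem_iUnion]
    constructor
    · rintro ⟨w, hw, hwv⟩
      obtain ⟨a, ha⟩ := (Projectivization.mk_eq_mk_iff ℂ w.1 v.1 w.2 v.2).1 hwv
      refine ⟨a, ?_⟩
      convert hw
    · rintro ⟨a, ha⟩
      exact ⟨_, ha, (Projectivization.mk_eq_mk_iff ℂ _ _ _ _).2 ⟨a, rfl⟩⟩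
  rw [h]
  exact isOpen_iUnion fun a =>
    hU.preimage (Continuous.subtype_mk (continuous_subtype_val.const_smul a) _)

/-- Two nonzero vectors are proportional exactly when all their `2 × 2` minors vanish. This exhibits
the quotient relation as closed, whence `ℙⁿ` is Hausdorff. -/
theorem mk_eq_mk_iff_mul (v w : Fin (n + 1) → ℂ) (hv : v ≠ 0) (hw : w ≠ 0) :
    (Projectivization.mk ℂ v hv : CP n) = Projectivization.mk ℂ w hw ↔
      ∀ i j, v i * w j = v j * w i := by
  rw [Projectivization.mk_eq_mk_iff']
  constructor
  · rintro ⟨a, rfl⟩ i j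
    simp only [Pi.smul_apply, smul_eq_mul]
    ring
  · intro h
    obtain ⟨k, hk⟩ := Function.ne_iff.1 hw
    refine ⟨v k / w k, funext fun i => ?_⟩
    have hk' : w k ≠ 0 := hk
    simp only [Pi.smul_apply, smul_eq_mul]
    field_simp
    linear_combination h k i

instance : T2Space (CP n) := by
  rw [t2Space_iff_of_isOpenQuotientMap isOpenQuotientMap_mk']
  have h : {q : {v : Fin (n + 1) → ℂ // v ≠ 0} × {v : Fin (n + 1) → ℂ // v ≠ 0} |
      (Projectivization.mk' ℂ q.1 : CP n) = Projectivization.mk' ℂ q.2} =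
      ⋂ i, ⋂ j, {q | q.1.1 i * q.2.1 j = q.1.1 j * q.2.1 i} := by
    ext q
    simp only [Set.mem_ofPred_eq, Set.mem_iInter]
    exact mk_eq_mk_iff_mul q.1.1 q.2.1 q.1.2 q.2.2
  rw [h]
  have h1 : ∀ i, Continuous fun q : {v : Fin (n + 1) → ℂ // v ≠ 0} × {v : Fin (n + 1) → ℂ // v ≠ 0} =>
      q.1.1 i := fun i => (continuous_apply i).comp (continuous_subtype_val.comp continuous_fst)
  have h2 : ∀ i, Continuous fun q : {v : Fin (n + 1) → ℂ // v ≠ 0} × {v : Fin (n + 1) → ℂ // v ≠ 0} =>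
      q.2.1 i := fun i => (continuous_apply i).comp (continuous_subtype_val.comp continuous_snd)
  exact isClosed_iInter fun i => isClosed_iInter fun j =>
    isClosed_eq ((h1 i).mul (h2 j)) ((h1 j).mul (h2 i))

instance : SecondCountableTopology (CP n) :=
  isOpenQuotientMap_mk'.isQuotientMap.secondCountableTopology isOpenQuotientMap_mk'.isOpenMap

theorem affineChart_mem_maximalAtlas (i : Fin (n + 1)) :
    affineChart (n := n) i ∈ IsManifold.maximalAtlas 𝓘(ℂ, Fin n → ℂ) ω (CP n) :=
  IsManifold.subset_maximalAtlas (Set.mem_range_self i)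

theorem contMDiff_ofAffine (i : Fin (n + 1)) :
    ContMDiff 𝓘(ℂ, Fin n → ℂ) 𝓘(ℂ, Fin n → ℂ) ω (ofAffine (n := n) i) := by
  rw [← contMDiffOn_univ]
  exact contMDiffOn_symm_of_mem_maximalAtlas (affineChart_mem_maximalAtlas i)

theorem ofAffine_affineCoord {i : Fin (n + 1)} {v : CP n} (hv : v.rep i ≠ 0) :
    ofAffine i (affineCoord i v) = v :=
  (affineChart i).left_inv hv

theorem affineCoord_ofAffine (i : Fin (n + 1)) (w : Fin n → ℂ) :
    affineCoord i (ofAffine i w) = w :=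
  (affineChart i).right_inv (Set.mem_univ _)

theorem mk_eq_ofAffine {i : Fin (n + 1)} {v : Fin (n + 1) → ℂ} (hv : v ≠ 0) (hi : v i ≠ 0) :
    (Projectivization.mk ℂ v hv : CP n) = ofAffine i fun j => v (i.succAbove j) / v i := by
  rw [← affineCoord_mk i v hv, ofAffine_affineCoord]
  exact (rep_mk_eq_zero_iff v hv i).not.2 hi

/-- A map to projective space with holomorphic homogeneous coordinates is holomorphic. -/
theorem contMDiff_mk {E H M : Type*} [NormedAddCommGroup E] [NormedSpace ℂ E] [TopologicalSpace H]
    {I : ModelWithCorners ℂ E H} [TopologicalSpace M] [ChartedSpace H M]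
    {f : M → Fin (n + 1) → ℂ} (hf : ContMDiff I 𝓘(ℂ, Fin (n + 1) → ℂ) ω f) (h0 : ∀ x, f x ≠ 0) :
    ContMDiff I 𝓘(ℂ, Fin n → ℂ) ω fun x => (Projectivization.mk ℂ (f x) (h0 x) : CP n) := by
  intro x
  obtain ⟨i, hi⟩ := Function.ne_iff.1 (h0 x)
  have hi : f x i ≠ 0 := hi
  have hev : ∀ᶠ y in 𝓝 x, f y i ≠ 0 :=
    (((continuous_apply i).comp hf.continuous).continuousAt).eventually_ne hi
  have hc : ContDiffAt ℂ ω (fun v : Fin (n + 1) → ℂ => fun j : Fin n => v (i.succAbove j) / v i)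
      (f x) := by
    refine contDiffAt_pi.2 fun j => ContDiffAt.div ?_ ?_ hi
    · exact (contDiff_apply ℂ ℂ _).contDiffAt
    · exact (contDiff_apply ℂ ℂ _).contDiffAt
  refine ((contMDiff_ofAffine i).contMDiffAt.comp x
    (hc.contMDiffAt.comp x (hf x))).congr_of_eventuallyEq ?_
  filter_upwards [hev] with y hy
  exact mk_eq_ofAffine (h0 y) hy

end CP

/-! ### Unimodular atlases and the canonical bundle -/

section Unimodular

variable {d : ℕ}

/-- A top form is its value on the standard basis times the determinant, and determinants are
multiplicative. -/
theorem ContinuousAlternatingMap.compContinuousLinearMap_eq_det_smul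
    (η : (Fin d → ℂ) [⋀^Fin d]→L[ℂ] ℂ) (L : (Fin d → ℂ) →L[ℂ] (Fin d → ℂ)) :
    η.compContinuousLinearMap L = LinearMap.det (L : (Fin d → ℂ) →ₗ[ℂ] (Fin d → ℂ)) • η := by
  ext v
  have h := η.toAlternatingMap.eq_smul_basis_det (Pi.basisFun ℂ (Fin d))
  have h' : ∀ w, η w = η (Pi.basisFun ℂ (Fin d)) * (Pi.basisFun ℂ (Fin d)).det w := fun w =>
    congrArg (fun f : (Fin d → ℂ) [⋀^Fin d]→ₗ[ℂ] ℂ => f w) h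
  have hd := (Pi.basisFun ℂ (Fin d)).det_comp (L : (Fin d → ℂ) →ₗ[ℂ] (Fin d → ℂ)) v
  change η (L ∘ v) = LinearMap.det (L : (Fin d → ℂ) →ₗ[ℂ] (Fin d → ℂ)) * η v
  rw [h' v, h' (L ∘ v)]
  change _ * (Pi.basisFun ℂ (Fin d)).det ((L : (Fin d → ℂ) →ₗ[ℂ] (Fin d → ℂ)) ∘ v) = _
  rw [hd]
  ring

variable (d) in
/-- The determinant as a top form on `ℂ^d`. -/
noncomputable def detForm : (Fin d → ℂ) [⋀^Fin d]→L[ℂ] ℂ :=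
  { (Matrix.detRowAlternating : (Fin d → ℂ) [⋀^Fin d]→ₗ[ℂ] ℂ) with
    cont := Continuous.matrix_det continuous_id }

theorem detForm_two (v : Fin 2 → Fin 2 → ℂ) : detForm 2 v = v 0 0 * v 1 1 - v 0 1 * v 1 0 :=
  Matrix.det_fin_two _

variable (d) in
/-- Top forms on `ℂ^d` are the multiples of the determinant. -/
noncomputable def topFormEquiv : ((Fin d → ℂ) [⋀^Fin d]→L[ℂ] ℂ) ≃L[ℂ] ℂ :=
  { toFun := fun η => η (Pi.basisFun ℂ (Fin d))
    map_add' := fun _ _ => rfl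
    map_smul' := fun _ _ => rfl
    invFun := fun c => c • detForm d
    left_inv := fun η => by
      ext v
      have h := η.toAlternatingMap.eq_smul_basis_det (Pi.basisFun ℂ (Fin d))
      have h' := congrArg (fun f : (Fin d → ℂ) [⋀^Fin d]→ₗ[ℂ] ℂ => f v) h
      rw [Pi.basisFun_det] at h'
      exact h'.symm
    right_inv := fun c => by
      have h : detForm d (Pi.basisFun ℂ (Fin d)) = 1 := by
        have := (Pi.basisFun ℂ (Fin d)).det_self
        rwa [Pi.basisFun_det] at this
      simp [h]
    continuous_toFun := continuous_eval_const _
    continuous_invFun := continuous_id.smul continuous_const }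

variable {M : Type*} [TopologicalSpace M] [ChartedSpace (Fin d → ℂ) M]

variable (d M) in
/-- All coordinate changes of the atlas of `M` have Jacobian determinant `1`. -/
def IsUnimodularAtlas [IsManifold 𝓘(ℂ, Fin d → ℂ) 1 M] : Prop :=
  ∀ i j : atlas (Fin d → ℂ) M, ∀ x ∈ i.1.source ∩ j.1.source,
    LinearMap.det ((tangentBundleCore 𝓘(ℂ, Fin d → ℂ) M).coordChange i j x :
      (Fin d → ℂ) →ₗ[ℂ] (Fin d → ℂ)) = 1

namespace IsUnimodularAtlas

section

variable [IsManifold 𝓘(ℂ, Fin d → ℂ) 1 M] (h : IsUnimodularAtlas d M)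

include h

/-- The transition functions of the canonical bundle are multiplication by Jacobian determinants,
here all equal to `1`. -/
theorem coordChange_eq (i j : atlas (Fin d → ℂ) M) {x : M} (hx : x ∈ i.1.source ∩ j.1.source) :
    (canonicalBundleCore d M).coordChange i j x = ContinuousLinearMap.id ℂ _ := by
  refine ContinuousLinearMap.ext fun η => ?_
  change η.compContinuousLinearMap _ = η
  rw [ContinuousAlternatingMap.compContinuousLinearMap_eq_det_smul, h j i x hx.symm, one_smul]

theorem isContMDiff :
    (canonicalBundleCore d M).IsContMDiff 𝓘(ℂ, Fin d → ℂ) ω where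
  contMDiffOn_coordChange i j :=
    contMDiffOn_const.congr fun _ hx => h.coordChange_eq i j hx

/-- A fibre element is recorded in the chart chosen at its base point, and that choice may jump from
point to point. Unimodularity makes the recorded form the same in every chart, so the second
component is a global fibre coordinate. -/
theorem trivializationAt_snd (x : M) {p : CanonicalBundle d M}
    (hp : p.proj ∈ (chartAt (Fin d → ℂ) x).source) :
    (trivializationAt ((Fin d → ℂ) [⋀^Fin d]→L[ℂ] ℂ) (CanonicalFiber d M) x p).2 = p.2 := by
  change (canonicalBundleCore d M).coordChange _ (achart (Fin d → ℂ) x) p.proj p.2 = p.2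
  have hp' := (canonicalBundleCore d M).mem_baseSet_at p.proj
  exact congrArg (fun L : ((Fin d → ℂ) [⋀^Fin d]→L[ℂ] ℂ) →L[ℂ] ((Fin d → ℂ) [⋀^Fin d]→L[ℂ] ℂ) => L p.2)
    (h.coordChange_eq ((canonicalBundleCore d M).indexAt p.proj) (achart (Fin d → ℂ) x) ⟨hp', hp⟩)

end

variable [IsManifold 𝓘(ℂ, Fin d → ℂ) ω M] (h : IsUnimodularAtlas d M)

include h

theorem contMDiff_snd :
    ContMDiff (𝓘(ℂ, Fin d → ℂ).prod 𝓘(ℂ, (Fin d → ℂ) [⋀^Fin d]→L[ℂ] ℂ))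
      𝓘(ℂ, (Fin d → ℂ) [⋀^Fin d]→L[ℂ] ℂ) ω
      fun p : CanonicalBundle d M => (p.2 : (Fin d → ℂ) [⋀^Fin d]→L[ℂ] ℂ) := by
  have := h.isContMDiff
  intro p
  set e := trivializationAt ((Fin d → ℂ) [⋀^Fin d]→L[ℂ] ℂ) (CanonicalFiber d M) p.proj
  have hp : p ∈ e.source := FiberBundle.mem_trivializationAt_proj_source
  have he := (e.contMDiffOn (IB := 𝓘(ℂ, Fin d → ℂ)) (n := ω)).contMDiffAt (e.open_source.mem_nhds hp)
  refine he.snd.congr_of_eventuallyEq ?_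
  filter_upwards [e.open_source.mem_nhds hp] with q hq
  exact (h.trivializationAt_snd p.proj (e.mem_source.1 hq)).symm

theorem contMDiff_mk :
    ContMDiff (𝓘(ℂ, Fin d → ℂ).prod 𝓘(ℂ, (Fin d → ℂ) [⋀^Fin d]→L[ℂ] ℂ))
      (𝓘(ℂ, Fin d → ℂ).prod 𝓘(ℂ, (Fin d → ℂ) [⋀^Fin d]→L[ℂ] ℂ)) ω
      fun q : M × ((Fin d → ℂ) [⋀^Fin d]→L[ℂ] ℂ) => (⟨q.1, q.2⟩ : CanonicalBundle d M) := by
  intro q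
  rw [Bundle.contMDiffAt_totalSpace]
  refine ⟨contMDiffAt_fst, contMDiffAt_snd.congr_of_eventuallyEq ?_⟩
  filter_upwards [continuous_fst.continuousAt.eventually
    (chart_source_mem_nhds (Fin d → ℂ) q.1)] with r hr
  exact h.trivializationAt_snd q.1 (p := ⟨r.1, r.2⟩) hr

theorem hasTrivialCanonicalBundle : HasTrivialCanonicalBundle d M :=
  ⟨{ toFun := fun p => (p.proj, topFormEquiv d p.2)
     invFun := fun q => ⟨q.1, (topFormEquiv d).symm q.2⟩
     left_inv := fun p => by
       exact congrArg (fun η => (⟨p.proj, η⟩ : CanonicalBundle d M))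
         ((topFormEquiv d).symm_apply_apply p.2)
     right_inv := fun q => Prod.ext rfl ((topFormEquiv d).apply_symm_apply q.2)
     contMDiff_toFun := (Bundle.contMDiff_proj _).prodMk
       ((topFormEquiv d).contDiff.contMDiff.comp h.contMDiff_snd)
     contMDiff_invFun := h.contMDiff_mk.comp
       (contMDiff_fst.prodMk ((topFormEquiv d).symm.contDiff.contMDiff.comp
         _root_.contMDiff_snd)) },
    fun _ => rfl, fun x => (topFormEquiv d).toLinearMap.isLinear⟩

/-- In a unimodular atlas a constant top form is a holomorphic section of the canonical bundle. -/
theorem isHolomorphicTopForm_const (c : ℂ) :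
    IsHolomorphicTopForm (M := M)
      fun _ => (c • detForm d : (Fin d → ℂ) [⋀^Fin d]→L[ℂ] ℂ) :=
  h.contMDiff_mk.comp (contMDiff_id.prodMk contMDiff_const)

end IsUnimodularAtlas

end Unimodular

/-! ### The blow-up of the cone over a conic -/

namespace AOne

/-- In `Fin 2` the index `i + 1` is the other one; both charts are treated at once by writing `i`
and `i + 1`. -/
theorem fin_two_add_one_ne (i : Fin 2) : i + 1 ≠ i := by
  fin_cases i <;> decide

theorem fin_two_funext {α : Type*} (i : Fin 2) {x y : Fin 2 → α} (h : x i = y i)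
    (h' : x (i + 1) = y (i + 1)) : x = y := by
  funext k
  fin_cases i <;> fin_cases k <;> assumption

/-- The conic `v¹ v² = (v³)²` in the projective plane. -/
def conic : Set (CP 2) := {v | v.rep 0 * v.rep 1 = v.rep 2 ^ 2}

theorem mk_mem_conic_iff (v : Fin 3 → ℂ) (hv : v ≠ 0) :
    (Projectivization.mk ℂ v hv : CP 2) ∈ conic ↔ v 0 * v 1 = v 2 ^ 2 := by
  obtain ⟨a, ha, h⟩ := CP.rep_mk v hv
  rw [h, h, h]
  change _ * _ = _ ^ 2 ↔ _
  have ha2 : a ^ 2 ≠ 0 := pow_ne_zero 2 ha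
  constructor
  · intro h'
    linear_combination a ^ 2 * h'
  · intro h'
    refine mul_left_cancel₀ ha2 ?_
    linear_combination h'

theorem incident_mk_iff (u : C3) (v : Fin 3 → ℂ) (hv : v ≠ 0) :
    Incident u (Projectivization.mk ℂ v hv) ↔ ∀ j k, u j * v k = u k * v j := by
  obtain ⟨a, ha, h⟩ := CP.rep_mk v hv
  refine forall_congr' fun j => forall_congr' fun k => ?_
  rw [h, h]
  constructor
  · intro h'
    linear_combination a * h'
  · intro h'
    refine mul_left_cancel₀ ha ?_
    linear_combination h'

theorem isClosed_conic : IsClosed conic := by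
  rw [← CP.isQuotientMap_mk'.isClosed_preimage]
  have h : (fun v : {v : Fin 3 → ℂ // v ≠ 0} => (Projectivization.mk' ℂ v : CP 2)) ⁻¹' conic =
      {v | v.1 0 * v.1 1 = v.1 2 ^ 2} := by
    ext v
    exact mk_mem_conic_iff v.1 v.2
  rw [h]
  have h1 : ∀ i, Continuous fun v : {v : Fin 3 → ℂ // v ≠ 0} => v.1 i :=
    fun i => (continuous_apply i).comp continuous_subtype_val
  exact isClosed_eq ((h1 0).mul (h1 1)) ((h1 2).pow 2)

/-- Openness of the projection to `ℙ²` is what matters: the product of the identity with an open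
quotient map is again a quotient map, so closedness can be tested on homogeneous coordinates. -/
theorem isClosed_incident : IsClosed {p : C3 × CP 2 | Incident p.1 p.2} := by
  rw [← (IsOpenQuotientMap.id.prodMap CP.isOpenQuotientMap_mk').isQuotientMap.isClosed_preimage]
  have h : (Prod.map id fun v : {v : Fin 3 → ℂ // v ≠ 0} => (Projectivization.mk' ℂ v : CP 2)) ⁻¹'
      {p : C3 × CP 2 | Incident p.1 p.2} =
      ⋂ j, ⋂ k, {q | q.1 j * q.2.1 k = q.1 k * q.2.1 j} := by
    ext q
    simp only [Set.mem_iInter]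
    exact incident_mk_iff q.1 q.2.1 q.2.2
  rw [h]
  have h1 : ∀ i, Continuous fun q : C3 × {v : Fin 3 → ℂ // v ≠ 0} => q.1 i := fun i => by fun_prop
  have h2 : ∀ i, Continuous fun q : C3 × {v : Fin 3 → ℂ // v ≠ 0} => q.2.1 i :=
    fun i => (continuous_apply i).comp (continuous_subtype_val.comp continuous_snd)
  exact isClosed_iInter fun j => isClosed_iInter fun k =>
    isClosed_eq ((h1 j).mul (h2 k)) ((h1 k).mul (h2 j))

/-- Replacing each `u_j v_k` by `u_k v_j` gives `u_j² (v_0 v_1 - v_2²) = v_j² (u_0 u_1 - u_2²)`, and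
some `u_j` is nonzero. The same identity proves `eq_of_incident`, where some `v_j` is nonzero
automatically. -/
theorem mem_conic_of_incident {u : C3} (hu : u ≠ 0) (he : u 0 * u 1 = u 2 ^ 2) {v : CP 2}
    (h : Incident u v) : v ∈ conic := by
  obtain ⟨j, hj⟩ : ∃ j, u j ≠ 0 := by
    by_contra! h0
    exact hu (by ext j; simpa using h0 j)
  change v.rep 0 * v.rep 1 = v.rep 2 ^ 2
  refine mul_left_cancel₀ (pow_ne_zero 2 hj) ?_
  linear_combination (u j * v.rep 1) * h j 0 + (u 0 * v.rep j) * h j 1 -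
    (u j * v.rep 2 + u 2 * v.rep j) * h j 2 + v.rep j ^ 2 * he

theorem eq_of_incident {u : C3} {v : CP 2} (hv : v ∈ conic) (h : Incident u v) :
    u 0 * u 1 = u 2 ^ 2 := by
  obtain ⟨j, hj⟩ := CP.exists_rep_ne_zero v
  have hv : v.rep 0 * v.rep 1 = v.rep 2 ^ 2 := hv
  refine mul_left_cancel₀ (pow_ne_zero 2 hj) ?_
  linear_combination (-(v.rep j * u 1)) * h j 0 - (v.rep 0 * u j) * h j 1 +
    (v.rep j * u 2 + v.rep 2 * u j) * h j 2 + u j ^ 2 * hv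

/-- `V_ε` is cut out by the incidence relation and the conic. -/
theorem mem_V_iff_incident {ε : ℝ} (hε : 0 < ε) {p : C3 × CP 2} :
    p ∈ V ε ↔ ‖p.1‖ < ε ∧ Incident p.1 p.2 ∧ p.2 ∈ conic := by
  rw [mem_V_iff hε, mem_ball_zero_iff]
  constructor
  · rintro ⟨hp, hn⟩
    refine ⟨hn, ?_⟩
    exact closure_minimal (t := {q : C3 × CP 2 | Incident q.1 q.2} ∩ Prod.snd ⁻¹' conic)
      (fun q hq => ⟨hq.2, mem_conic_of_incident hq.1.2 hq.1.1.2 hq.2⟩)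
      (isClosed_incident.inter (isClosed_conic.preimage continuous_snd)) hp
  · rintro ⟨hn, hi, hv⟩
    refine ⟨?_, hn⟩
    -- Over the origin, `(0, v)` is approached by the points `(s v, v)` with `s ≠ 0`, which lie in
    -- `W_ε` for small `s`; the other points already belong to `W_ε`.
    by_cases h0 : p.1 = 0
    · obtain ⟨u, v⟩ := p
      obtain rfl : u = 0 := h0
      have hw : WithLp.toLp 2 v.rep ≠ (0 : C3) := fun h => v.rep_nonzero (by
        funext j
        simpa using congrArg (fun u : C3 => u j) h)
      have hc : Continuous fun s : ℂ => s • (WithLp.toLp 2 v.rep : C3) := by fun_prop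
      have ht : Filter.Tendsto (fun s : ℂ => (s • (WithLp.toLp 2 v.rep : C3), v)) (𝓝[≠] 0)
          (𝓝 (0, v)) := by
        refine Filter.Tendsto.mono_left ?_ nhdsWithin_le_nhds
        have := (hc.prodMk (continuous_const (y := v))).tendsto 0
        simpa using this
      have hev : ∀ᶠ s : ℂ in 𝓝[≠] 0, ‖s • (WithLp.toLp 2 v.rep : C3)‖ < ε := by
        refine Filter.Eventually.filter_mono nhdsWithin_le_nhds ?_
        refine (hc.norm.continuousAt (x := 0)).eventually_lt continuousAt_const ?_
        simpa using hε
      refine mem_closure_of_tendsto ht ?_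
      filter_upwards [hev, self_mem_nhdsWithin] with s hs hs0
      have hi' : Incident (s • (WithLp.toLp 2 v.rep : C3)) v := fun j k => by
        simp only [PiLp.smul_apply, smul_eq_mul]
        ring
      exact ⟨⟨⟨by simpa using hs.le, eq_of_incident hv hi'⟩, smul_ne_zero hs0 hw⟩, hi'⟩
    · exact subset_closure ⟨⟨⟨by simpa using hn.le, eq_of_incident hv hi⟩, h0⟩, hi⟩

/-! ### Affine charts of the conic and of the tautological line bundle over it -/

/-- The point with affine coordinate `t` of the affine line `{u ∈ cone | u_i = 1}`. -/
def lineVec (i : Fin 2) (t : ℂ) : Fin 3 → ℂ := i.castSucc.insertNth 1 ![t ^ 2, t]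

@[simp] theorem lineVec_same (i : Fin 2) (t : ℂ) : lineVec i t i.castSucc = 1 := by
  simp [lineVec]

@[simp] theorem lineVec_other (i : Fin 2) (t : ℂ) : lineVec i t (i + 1).castSucc = t ^ 2 := by
  fin_cases i <;> rfl

@[simp] theorem lineVec_two (i : Fin 2) (t : ℂ) : lineVec i t 2 = t := by
  fin_cases i <;> rfl

theorem lineVec_ne_zero (i : Fin 2) (t : ℂ) : lineVec i t ≠ 0 := CP.insertNth_ne_zero _ _

theorem forall_fin_three (i : Fin 2) {P : Fin 3 → Prop} :
    (∀ k, P k) ↔ P i.castSucc ∧ P (i + 1).castSucc ∧ P 2 := by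
  fin_cases i
  · exact ⟨fun h => ⟨h _, h _, h _⟩, fun h k => by fin_cases k; exacts [h.1, h.2.1, h.2.2]⟩
  · exact ⟨fun h => ⟨h _, h _, h _⟩, fun h k => by fin_cases k; exacts [h.2.1, h.1, h.2.2]⟩

theorem cone_eq_iff (i : Fin 2) (u : Fin 3 → ℂ) :
    u 0 * u 1 = u 2 ^ 2 ↔ u i.castSucc * u (i + 1).castSucc = u 2 ^ 2 := by
  fin_cases i
  · rfl
  · rw [mul_comm]; rfl

theorem lineVec_mem (i : Fin 2) (t : ℂ) : lineVec i t 0 * lineVec i t 1 = lineVec i t 2 ^ 2 := by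
  rw [cone_eq_iff i]
  simp

/-- The tautological map from the line bundle over the `i`-th affine line of the conic to
`ℂ³`. -/
noncomputable def lineMap (i : Fin 2) (x : Fin 2 → ℂ) : C3 :=
  x i • WithLp.toLp 2 (lineVec i (x (i + 1)))

theorem lineMap_apply (i : Fin 2) (x : Fin 2 → ℂ) (k : Fin 3) :
    lineMap i x k = x i * lineVec i (x (i + 1)) k := rfl

theorem contDiff_lineMap (i : Fin 2) : ContDiff ℂ ω (lineMap i) := by
  rw [contDiff_euclidean]
  rw [forall_fin_three i]
  simp only [lineMap_apply, lineVec_same, lineVec_other, lineVec_two]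
  refine ⟨?_, ?_, ?_⟩ <;> fun_prop

/-- The point of the conic with `i`-th affine coordinates `(t², t)`. -/
noncomputable def conicPoint (i : Fin 2) (t : ℂ) : CP 2 := CP.ofAffine i.castSucc ![t ^ 2, t]

theorem conicPoint_eq_mk (i : Fin 2) (t : ℂ) :
    conicPoint i t = Projectivization.mk ℂ (lineVec i t) (lineVec_ne_zero i t) := rfl

/-- Incidence says that `u` is a multiple of `lineVec i t`, whose `i`-th coordinate is `1`; the
factor must be `u_i`. -/
theorem incident_conicPoint_iff {u : C3} {i : Fin 2} {t : ℂ} :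
    Incident u (conicPoint i t) ↔ u = u i.castSucc • WithLp.toLp 2 (lineVec i t) := by
  rw [conicPoint_eq_mk, incident_mk_iff]
  constructor
  · intro h
    ext k
    have := h i.castSucc k
    rw [lineVec_same, mul_one] at this
    exact this.symm
  · intro h j k
    rw [h]
    simp only [PiLp.smul_apply, smul_eq_mul]
    ring

theorem conicPoint_mem_conic (i : Fin 2) (t : ℂ) : conicPoint i t ∈ conic :=
  (mk_mem_conic_iff _ _).2 (lineVec_mem i t)

/-- After division by `v_i²`, the equation of the conic makes the first affine coordinate the square
of the second, so the latter determines the point. -/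
theorem eq_conicPoint {v : CP 2} (hv : v ∈ conic) {i : Fin 2} (hi : v.rep i.castSucc ≠ 0) :
    v = conicPoint i (CP.affineCoord i.castSucc v 1) := by
  have hv' := (cone_eq_iff i v.rep).1 hv
  have h : CP.affineCoord i.castSucc v = ![CP.affineCoord i.castSucc v 1 ^ 2,
      CP.affineCoord i.castSucc v 1] := by
    have h2 : (i.castSucc : Fin 3).succAbove 1 = 2 := by fin_cases i <;> rfl
    have h1 : (i.castSucc : Fin 3).succAbove 0 = (i + 1).castSucc := by fin_cases i <;> rfl
    funext k
    fin_cases k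
    · simp only [CP.affineCoord, Fin.zero_eta, Matrix.cons_val_zero, h1, h2]
      field_simp
      linear_combination hv'
    · simp
  rw [conicPoint, ← h, CP.ofAffine_affineCoord hi]

/-- On the conic `v¹ = v² = 0` would force `v³ = 0`, so two of the three affine charts suffice. -/
theorem exists_rep_castSucc_ne_zero {v : CP 2} (hv : v ∈ conic) :
    ∃ i : Fin 2, v.rep i.castSucc ≠ 0 := by
  by_contra! h
  have h0 : v.rep 0 = 0 := h 0
  have h1 : v.rep 1 = 0 := h 1
  have hv : v.rep 0 * v.rep 1 = v.rep 2 ^ 2 := hv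
  refine v.rep_nonzero (funext fun k => ?_)
  fin_cases k
  · exact h0
  · exact h1
  · rw [h0, zero_mul] at hv
    exact pow_eq_zero_iff two_ne_zero |>.1 hv.symm

theorem lineMap_mem_V_iff {ε : ℝ} (hε : 0 < ε) (i : Fin 2) (x : Fin 2 → ℂ) :
    (lineMap i x, conicPoint i (x (i + 1))) ∈ V ε ↔ ‖lineMap i x‖ < ε := by
  rw [mem_V_iff_incident hε]
  refine ⟨fun h => h.1, fun h => ⟨h, ?_, conicPoint_mem_conic _ _⟩⟩
  refine incident_conicPoint_iff.2 ?_
  simp [lineMap]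

/-- The coordinates of the blow-up in an affine chart: the point on the line and the line. -/
noncomputable def blowupProj (i : Fin 2) : C3 × (Fin 2 → ℂ) →L[ℂ] (Fin 2 → ℂ) :=
  ContinuousLinearMap.pi fun k =>
    if k = i then EuclideanSpace.proj i.castSucc ∘L ContinuousLinearMap.fst ℂ C3 (Fin 2 → ℂ)
    else ContinuousLinearMap.proj 1 ∘L ContinuousLinearMap.snd ℂ C3 (Fin 2 → ℂ)

@[simp] theorem blowupProj_same (i : Fin 2) (y : C3 × (Fin 2 → ℂ)) :
    blowupProj i y i = y.1 i.castSucc := by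
  simp [blowupProj]

@[simp] theorem blowupProj_other (i : Fin 2) (y : C3 × (Fin 2 → ℂ)) :
    blowupProj i y (i + 1) = y.2 1 := by
  simp [blowupProj]

theorem blowupProj_surjective (i : Fin 2) : Function.Surjective (blowupProj i) := fun x =>
  ⟨(WithLp.toLp 2 fun _ => x i, fun _ => x (i + 1)), fin_two_funext i (by simp) (by simp)⟩

/-- The product charts of `ℂ³ × ℙ²`, with values in the model vector space. -/
@[reducible]
noncomputable def chartedSpaceProd : ChartedSpace (C3 × (Fin 2 → ℂ)) (C3 × CP 2) :=
  prodChartedSpace C3 C3 (Fin 2 → ℂ) (CP 2)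

attribute [local instance] chartedSpaceProd

/-- Graph charts take values in a single normed space; this identification carries their results
over to the product model of `ℂ³ × ℙ²`. -/
theorem modelWithCornersSelf_C3_prod :
    𝓘(ℂ, C3 × (Fin 2 → ℂ)) = 𝓘(ℂ, C3).prod 𝓘(ℂ, Fin 2 → ℂ) :=
  modelWithCornersSelf_prod

theorem isManifold_C3_prod : IsManifold 𝓘(ℂ, C3 × (Fin 2 → ℂ)) ω (C3 × CP 2) := by
  have h : IsManifold (𝓘(ℂ, C3).prod 𝓘(ℂ, Fin 2 → ℂ)) ω (C3 × CP 2) := inferInstance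
  rw [← modelWithCornersSelf_C3_prod] at h
  exact h

attribute [local instance] isManifold_C3_prod

/-- The graph chart of `V_ε` over the points with `v_i ≠ 0`. -/
noncomputable def blowupGraph {ε : ℝ} (hε : 0 < ε) (i : Fin 2) :
    GraphChart ℂ (Fin 2 → ℂ) (C3 × (Fin 2 → ℂ)) ω (V ε) where
  ambient := (OpenPartialHomeomorph.refl C3).prod (CP.affineChart i.castSucc)
  ambient_mem := IsManifold.subset_maximalAtlas
    ⟨_, rfl, _, Set.mem_range_self _, rfl⟩
  proj := blowupProj i
  dom := {x | ‖lineMap i x‖ < ε}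
  isOpen_dom := isOpen_lt (contDiff_lineMap i).continuous.norm continuous_const
  param x := (lineMap i x, ![x (i + 1) ^ 2, x (i + 1)])
  contDiffOn_param := by
    refine ((contDiff_lineMap i).prodMk (contDiff_pi.2 fun k => ?_)).contDiffOn
    fin_cases k <;> simp <;> fun_prop
  proj_param x _ := fin_two_funext i (by simp [lineMap_apply]) (by simp)
  param_mem _ _ := ⟨Set.mem_univ _, Set.mem_univ _⟩
  symm_param_mem x hx := (lineMap_mem_V_iff hε i x).2 hx
  param_proj y hy hs _ := by
    obtain ⟨-, hi, hc⟩ := (mem_V_iff_incident hε).1 hy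
    have hv : y.2.rep i.castSucc ≠ 0 := hs.2
    have h := eq_conicPoint hc hv
    set t := CP.affineCoord i.castSucc y.2 1 with ht
    have ha : CP.affineCoord i.castSucc y.2 = ![t ^ 2, t] := by
      rw [h, conicPoint, CP.affineCoord_ofAffine]
    -- Incidence now reads `u = u_i • lineVec i t`, so `u_i` and `t` recover the whole point.
    rw [h, incident_conicPoint_iff] at hi
    change (lineMap i (blowupProj i (y.1, CP.affineCoord i.castSucc y.2)),
      ![blowupProj i (y.1, CP.affineCoord i.castSucc y.2) (i + 1) ^ 2,
        blowupProj i (y.1, CP.affineCoord i.castSucc y.2) (i + 1)]) =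
      (y.1, CP.affineCoord i.castSucc y.2)
    rw [lineMap, blowupProj_same, blowupProj_other, ha]
    exact Prod.ext hi.symm rfl

theorem mem_blowupGraph_source {ε : ℝ} (hε : 0 < ε) (i : Fin 2) {p : C3 × CP 2} :
    p ∈ (blowupGraph hε i).ambient.source ↔ p.2.rep i.castSucc ≠ 0 :=
  ⟨fun h => h.2, fun h => ⟨Set.mem_univ _, h⟩⟩

theorem proj_mem_blowupGraph_dom {ε : ℝ} (hε : 0 < ε) (i : Fin 2) (p : V ε)
    (hp : p.1.2.rep i.castSucc ≠ 0) :
    (blowupGraph hε i).proj ((blowupGraph hε i).ambient p) ∈ (blowupGraph hε i).dom := by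
  obtain ⟨hn, hi, hc⟩ := (mem_V_iff_incident hε).1 p.2
  rw [eq_conicPoint hc hp, incident_conicPoint_iff] at hi
  change ‖lineMap i (blowupProj i (p.1.1, CP.affineCoord i.castSucc p.1.2))‖ < ε
  rw [lineMap, blowupProj_same, blowupProj_other, ← hi]
  exact hn

theorem exists_rep_ne_zero_of_V {ε : ℝ} (hε : 0 < ε) (p : V ε) :
    ∃ i : Fin 2, p.1.2.rep i.castSucc ≠ 0 :=
  exists_rep_castSucc_ne_zero ((mem_V_iff_incident hε).1 p.2).2.2

/-- The atlas of `V_ε` with two charts. -/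
noncomputable def blowupAtlas {ε : ℝ} (hε : 0 < ε) :
    GraphAtlas ℂ (Fin 2 → ℂ) (C3 × (Fin 2 → ℂ)) ω (V ε) (Fin 2) where
  graph := blowupGraph hε
  idx p := (exists_rep_ne_zero_of_V hε p).choose
  mem_source p := (mem_blowupGraph_source hε _).2 (exists_rep_ne_zero_of_V hε p).choose_spec
  mem_dom p := proj_mem_blowupGraph_dom hε _ p (exists_rep_ne_zero_of_V hε p).choose_spec

theorem lineMap_zero {i : Fin 2} {x : Fin 2 → ℂ} (hx : x i = 0) : lineMap i x = 0 := by
  rw [lineMap, hx, zero_smul]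

theorem zero_conicPoint_mem_V {ε : ℝ} (hε : 0 < ε) (i : Fin 2) (t : ℂ) :
    ((0, conicPoint i t) : C3 × CP 2) ∈ V ε :=
  (mem_V_iff_incident hε).2 ⟨by simpa using hε, fun j k => by simp, conicPoint_mem_conic i t⟩

theorem nonempty_V {ε : ℝ} (hε : 0 < ε) : Nonempty (V ε) := ⟨⟨_, zero_conicPoint_mem_V hε 0 0⟩⟩

end AOne

namespace AOne

attribute [local instance] chartedSpaceProd isManifold_C3_prod

section Structures

open Manifold

variable {ε : ℝ}

instance instNonemptyV [h : Fact (0 < ε)] : Nonempty (V ε) := nonempty_V h.out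

/-! ### The complex structure of `V_ε` -/

/-- The complex structure of `V_ε`. -/
@[reducible]
noncomputable def chartedSpaceV [h : Fact (0 < ε)] : ChartedSpace (Fin 2 → ℂ) (V ε) :=
  (blowupAtlas h.out).chartedSpace

attribute [local instance] chartedSpaceV

theorem isManifold_V [h : Fact (0 < ε)] : IsManifold 𝓘(ℂ, Fin 2 → ℂ) ω (V ε) :=
  (blowupAtlas h.out).isManifold

attribute [local instance] isManifold_V

theorem isSmoothEmbedding_V_self [h : Fact (0 < ε)] :
    IsSmoothEmbedding 𝓘(ℂ, Fin 2 → ℂ) 𝓘(ℂ, C3 × (Fin 2 → ℂ)) ω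
      (Subtype.val : V ε → C3 × CP 2) :=
  (blowupAtlas h.out).isSmoothEmbedding (fun i => blowupProj_surjective i) 3 (by simp)

theorem isSmoothEmbedding_V [h : Fact (0 < ε)] :
    IsSmoothEmbedding 𝓘(ℂ, Fin 2 → ℂ) (𝓘(ℂ, C3).prod 𝓘(ℂ, Fin 2 → ℂ)) ω
      (Subtype.val : V ε → C3 × CP 2) := by
  have h := isSmoothEmbedding_V_self (ε := ε)
  rw [modelWithCornersSelf_C3_prod] at h
  exact h

/-! ### The exceptional divisor -/

theorem mem_E_iff {hε : 0 < ε} {p : V ε} : p ∈ E hε ↔ p.1.1 = 0 := Iff.rfl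

/-- The graph chart of `E` over the points with `v_i ≠ 0`. -/
noncomputable def excGraph [h : Fact (0 < ε)] (i : Fin 2) :
    GraphChart ℂ (Fin 1 → ℂ) (Fin 2 → ℂ) ω (E h.out : Set (V ε)) where
  ambient := (blowupGraph h.out i).chart
  ambient_mem := IsManifold.subset_maximalAtlas ⟨i, rfl⟩
  proj := ContinuousLinearMap.pi fun _ => ContinuousLinearMap.proj (i + 1)
  -- In the `i`-th chart of `V_ε`, `E` is the axis `x i = 0`. There `lineMap` vanishes and the norm
  -- bound is automatic, so the remaining coordinate ranges over all of `ℂ`.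
  dom := Set.univ
  isOpen_dom := isOpen_univ
  param t k := if k = i then 0 else t 0
  contDiffOn_param := by
    refine (contDiff_pi.2 fun k => ?_).contDiffOn
    split_ifs <;> fun_prop
  proj_param t _ := by
    funext k
    simp [Subsingleton.elim k 0]
  param_mem t _ := by
    change ‖lineMap i _‖ < ε
    rw [lineMap_zero (by simp), norm_zero]
    exact h.out
  symm_param_mem t _ := by
    rw [mem_E_iff, GraphChart.coe_chart_symm]
    · exact lineMap_zero (i := i) (x := fun k => if k = i then 0 else t 0) (by simp)
    · change ‖lineMap i _‖ < ε
      rw [lineMap_zero (by simp), norm_zero]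
      exact h.out
  param_proj y hy _ _ := by
    have hy : y.1.1 = 0 := hy
    refine fin_two_funext i ?_ ?_
    · change _ = blowupProj i (y.1.1, CP.affineCoord i.castSucc y.1.2) i
      rw [blowupProj_same, hy]
      simp
    · simp

instance instNonemptyE [h : Fact (0 < ε)] : Nonempty (E h.out : Set (V ε)) :=
  ⟨⟨⟨_, zero_conicPoint_mem_V h.out 0 0⟩, rfl⟩⟩

/-- The atlas of `E` with two charts. -/
noncomputable def excAtlas [h : Fact (0 < ε)] :
    GraphAtlas ℂ (Fin 1 → ℂ) (Fin 2 → ℂ) ω (E h.out : Set (V ε)) (Fin 2) where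
  graph := excGraph
  idx p := (blowupAtlas h.out).idx p.1
  mem_source p := ⟨(blowupAtlas h.out).mem_source p.1, (blowupAtlas h.out).mem_dom p.1⟩
  mem_dom _ := Set.mem_univ _

/-- The complex structure of `E`. -/
@[reducible]
noncomputable def chartedSpaceE [h : Fact (0 < ε)] :
    ChartedSpace (Fin 1 → ℂ) (E h.out : Set (V ε)) :=
  excAtlas.chartedSpace

attribute [local instance] chartedSpaceE

theorem isManifold_E [h : Fact (0 < ε)] :
    IsManifold 𝓘(ℂ, Fin 1 → ℂ) ω (E h.out : Set (V ε)) :=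
  excAtlas.isManifold

attribute [local instance] isManifold_E

theorem isSmoothEmbedding_E [h : Fact (0 < ε)] :
    IsSmoothEmbedding 𝓘(ℂ, Fin 1 → ℂ) 𝓘(ℂ, Fin 2 → ℂ) ω
      (Subtype.val : E (ε := ε) h.out → V ε) :=
  excAtlas.isSmoothEmbedding (fun i x => ⟨fun _ => x 0, by
    funext k
    simp [excAtlas, excGraph, Subsingleton.elim k 0]⟩) 1 (by simp)

/-! ### The punctured cone -/

/-- The projection of `ℂ³` to the coordinates `u_i` and `u_3`. -/
noncomputable def coneProj (i : Fin 2) : C3 →L[ℂ] (Fin 2 → ℂ) :=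
  ContinuousLinearMap.pi fun k =>
    if k = i then EuclideanSpace.proj i.castSucc else EuclideanSpace.proj 2

@[simp] theorem coneProj_same (i : Fin 2) (u : C3) : coneProj i u i = u i.castSucc := by
  simp [coneProj]

@[simp] theorem coneProj_other (i : Fin 2) (u : C3) : coneProj i u (i + 1) = u 2 := by
  simp [coneProj]

theorem coneProj_surjective (i : Fin 2) : Function.Surjective (coneProj i) := fun x =>
  ⟨WithLp.toLp 2 (Function.update (fun _ => x i) 2 (x (i + 1))), fin_two_funext i
    (by fin_cases i <;> simp) (by simp)⟩

/-- The point of the cone with `u_i = x_i` and `u_3 = x_{i+1}`. -/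
noncomputable def coneParam (i : Fin 2) (x : Fin 2 → ℂ) : C3 :=
  x i • WithLp.toLp 2 (lineVec i (x (i + 1) / x i))

theorem coneParam_apply (i : Fin 2) (x : Fin 2 → ℂ) (k : Fin 3) :
    coneParam i x k = x i * lineVec i (x (i + 1) / x i) k := rfl

theorem contDiffOn_coneParam (i : Fin 2) : ContDiffOn ℂ ω (coneParam i) {x | x i ≠ 0} := by
  rw [contDiffOn_euclidean, forall_fin_three i]
  simp only [coneParam_apply, lineVec_same, lineVec_other, lineVec_two]
  have h0 : ContDiff ℂ ω fun x : Fin 2 → ℂ => x i := contDiff_apply ℂ ℂ i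
  have h1 : ContDiffOn ℂ ω (fun x : Fin 2 → ℂ => x (i + 1) / x i) {x | x i ≠ 0} :=
    (contDiff_apply ℂ ℂ (i + 1)).contDiffOn.div h0.contDiffOn fun _ hx => hx
  exact ⟨h0.contDiffOn.mul contDiffOn_const, h0.contDiffOn.mul (h1.pow 2), h0.contDiffOn.mul h1⟩

/-- Where `u_i ≠ 0`, the equation of the cone gives the other of the first two coordinates as `u_3²
/ u_i`. -/
theorem coneParam_coneProj {i : Fin 2} {u : C3} (hu : u 0 * u 1 = u 2 ^ 2)
    (hi : u i.castSucc ≠ 0) : coneParam i (coneProj i u) = u := by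
  rw [cone_eq_iff i u] at hu
  ext k
  revert k
  rw [forall_fin_three i]
  simp only [coneParam_apply, lineVec_same, lineVec_other, lineVec_two, coneProj_same,
    coneProj_other, mul_one, true_and]
  constructor
  · field_simp
    exact hu.symm
  · field_simp

/-- The graph chart of the punctured cone over the points with `u_i ≠ 0`. -/
noncomputable def coneGraph (ε : ℝ) (i : Fin 2) :
    GraphChart ℂ (Fin 2 → ℂ) C3 ω (puncturedCone ε) where
  ambient := OpenPartialHomeomorph.refl C3
  ambient_mem := StructureGroupoid.id_mem_maximalAtlas _
  proj := coneProj i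
  dom := {x | x i ≠ 0 ∧ ‖coneParam i x‖ < ε}
  isOpen_dom := (contDiffOn_coneParam i).continuousOn.norm.isOpen_inter_preimage
    (isOpen_ne_fun (continuous_apply i) continuous_const) isOpen_Iio
  param := coneParam i
  contDiffOn_param := (contDiffOn_coneParam i).mono fun _ hx => hx.1
  proj_param x hx := by
    have h0 : x i ≠ 0 := hx.1
    refine fin_two_funext i (by simp [coneParam_apply]) ?_
    simp only [coneProj_other, coneParam_apply, lineVec_two]
    field_simp
  param_mem _ _ := Set.mem_univ _
  symm_param_mem x hx := by
    change coneParam i x ∈ _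
    refine ⟨⟨by simpa using hx.2, ?_⟩, fun h => hx.1 ?_⟩
    · have h := lineVec_mem i (x (i + 1) / x i)
      simp only [coneParam_apply]
      linear_combination x i ^ 2 * h
    · have := congrArg (fun u : C3 => u i.castSucc) h
      simpa [coneParam_apply] using this
  param_proj y hy _ hd := by
    have h : coneProj i y i ≠ 0 := hd.1
    rw [coneProj_same] at h
    exact coneParam_coneProj hy.1.2 h

theorem exists_castSucc_ne_zero {u : C3} (hu : u ∈ puncturedCone ε) :
    ∃ i : Fin 2, u i.castSucc ≠ 0 := by
  by_contra! h
  have h0 : u 0 = 0 := h 0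
  have h1 : u 1 = 0 := h 1
  have h2 : u 2 = 0 := by
    have := hu.1.2
    rw [h0, zero_mul] at this
    exact pow_eq_zero_iff two_ne_zero |>.1 this.symm
  refine hu.2 ?_
  ext k
  fin_cases k
  · exact h0
  · exact h1
  · exact h2

/-- The atlas of the punctured cone with two charts. -/
noncomputable def coneAtlas (ε : ℝ) :
    GraphAtlas ℂ (Fin 2 → ℂ) C3 ω (puncturedCone ε) (Fin 2) where
  graph := coneGraph ε
  idx u := (exists_castSucc_ne_zero u.2).choose
  mem_source _ := Set.mem_univ _
  mem_dom u := by
    have h := (exists_castSucc_ne_zero u.2).choose_spec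
    set i := (exists_castSucc_ne_zero u.2).choose
    change coneProj i u i ≠ 0 ∧ ‖coneParam i (coneProj i u)‖ < ε
    rw [coneProj_same, coneParam_coneProj u.2.1.2 h]
    exact ⟨h, by simpa using u.2.1.1⟩

instance instNonemptyPuncturedCone [h : Fact (0 < ε)] : Nonempty (puncturedCone ε) := by
  -- The points `s (1, s², s)` of the cone tend to `0`, so one with small `s ≠ 0` lies in the ball.
  have hc : Continuous fun s : ℂ => lineMap 0 fun _ => s :=
    (contDiff_lineMap 0).continuous.comp (continuous_pi fun _ => continuous_id)
  have hev : ∀ᶠ s : ℂ in 𝓝[≠] 0, ‖lineMap 0 fun _ => s‖ < ε := by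
    refine Filter.Eventually.filter_mono nhdsWithin_le_nhds ?_
    refine (hc.norm.continuousAt (x := 0)).eventually_lt continuousAt_const ?_
    simpa [lineMap_zero] using h.out
  obtain ⟨s, hs, hs0⟩ := (hev.and self_mem_nhdsWithin).exists
  refine ⟨⟨lineMap 0 fun _ => s, ⟨by simpa using hs, ?_⟩, fun h => hs0 ?_⟩⟩
  · have h := lineVec_mem 0 s
    simp only [lineMap_apply]
    linear_combination s ^ 2 * h
  · have := congrArg (fun u : C3 => u (0 : Fin 2).castSucc) h
    simp only [lineMap_apply, lineVec_same, mul_one] at this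
    exact this

/-- The complex structure of the punctured cone. -/
@[reducible]
noncomputable def chartedSpaceCone [Fact (0 < ε)] : ChartedSpace (Fin 2 → ℂ) (puncturedCone ε) :=
  (coneAtlas ε).chartedSpace

attribute [local instance] chartedSpaceCone

theorem isManifold_cone [Fact (0 < ε)] : IsManifold 𝓘(ℂ, Fin 2 → ℂ) ω (puncturedCone ε) :=
  (coneAtlas ε).isManifold

attribute [local instance] isManifold_cone

theorem isSmoothEmbedding_cone [Fact (0 < ε)] :
    IsSmoothEmbedding 𝓘(ℂ, Fin 2 → ℂ) 𝓘(ℂ, C3) ω (Subtype.val : puncturedCone ε → C3) :=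
  (coneAtlas ε).isSmoothEmbedding (fun i => coneProj_surjective i) 1 (by simp)

/-! ### The blow-up map away from the exceptional divisor -/

theorem ne_zero_of_mem_puncturedCone (u : puncturedCone ε) : (WithLp.ofLp u.1) ≠ 0 := fun h =>
  u.2.2 (by ext k; exact congrFun h k)

theorem mk_mem_V [h : Fact (0 < ε)] (u : puncturedCone ε) :
    ((u.1, Projectivization.mk ℂ (WithLp.ofLp u.1) (ne_zero_of_mem_puncturedCone u)) : C3 × CP 2) ∈
      V ε :=
  (mem_V_iff_incident h.out).2 ⟨by simpa using u.2.1.1,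
    (incident_mk_iff _ _ _).2 fun j k => mul_comm _ _, (mk_mem_conic_iff _ _).2 u.2.1.2⟩

/-- Incidence is proportionality, so a nonzero `u` admits only the line through it; this gives
injectivity of `σ` off `E`. -/
theorem eq_mk_of_incident {u : C3} {v : CP 2} (hu : WithLp.ofLp u ≠ 0) (h : Incident u v) :
    v = Projectivization.mk ℂ (WithLp.ofLp u) hu := by
  rw [← v.mk_rep, CP.mk_eq_mk_iff_mul]
  intro i j
  linear_combination h j i

/-- The inverse of the blow-up map away from the exceptional divisor. -/
noncomputable def liftCone [h : Fact (0 < ε)] (u : puncturedCone ε) : V ε := ⟨_, mk_mem_V u⟩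

theorem contMDiff_coe_V [Fact (0 < ε)] :
    ContMDiff 𝓘(ℂ, Fin 2 → ℂ) (𝓘(ℂ, C3).prod 𝓘(ℂ, Fin 2 → ℂ)) ω
      (Subtype.val : V ε → C3 × CP 2) :=
  isSmoothEmbedding_V.contMDiff

/-- An immersion that is a topological embedding detects holomorphy. Maps into `V_ε` can thus be
checked in `ℂ³ × ℙ²`, without its charts. -/
theorem contMDiff_V_iff [Fact (0 < ε)] {E H M : Type*} [NormedAddCommGroup E] [NormedSpace ℂ E]
    [TopologicalSpace H] {I : ModelWithCorners ℂ E H} [TopologicalSpace M] [ChartedSpace H M]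
    {f : M → V ε} :
    ContMDiff I 𝓘(ℂ, Fin 2 → ℂ) ω f ↔
      ContMDiff I (𝓘(ℂ, C3).prod 𝓘(ℂ, Fin 2 → ℂ)) ω fun x => (f x : C3 × CP 2) := by
  rw [ContMDiff.iff_comp_isImmersion isSmoothEmbedding_V.isImmersion]
  exact ⟨fun h => h.2, fun h => ⟨h.continuous.subtype_mk _, h⟩⟩

theorem contMDiff_cone_iff [Fact (0 < ε)] {E H M : Type*} [NormedAddCommGroup E] [NormedSpace ℂ E]
    [TopologicalSpace H] {I : ModelWithCorners ℂ E H} [TopologicalSpace M] [ChartedSpace H M]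
    {f : M → puncturedCone ε} :
    ContMDiff I 𝓘(ℂ, Fin 2 → ℂ) ω f ↔ ContMDiff I 𝓘(ℂ, C3) ω fun x => (f x : C3) := by
  rw [ContMDiff.iff_comp_isImmersion isSmoothEmbedding_cone.isImmersion]
  exact ⟨fun h => h.2, fun h => ⟨h.continuous.subtype_mk _, h⟩⟩

theorem contMDiff_E_iff [h : Fact (0 < ε)] {F H M : Type*} [NormedAddCommGroup F] [NormedSpace ℂ F]
    [TopologicalSpace H] {I : ModelWithCorners ℂ F H} [TopologicalSpace M] [ChartedSpace H M]
    {f : M → (E h.out : Set (V ε))} :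
    ContMDiff I 𝓘(ℂ, Fin 1 → ℂ) ω f ↔ ContMDiff I 𝓘(ℂ, Fin 2 → ℂ) ω fun x => (f x : V ε) := by
  rw [ContMDiff.iff_comp_isImmersion isSmoothEmbedding_E.isImmersion]
  exact ⟨fun h => h.2, fun h => ⟨h.continuous.subtype_mk _, h⟩⟩

theorem contMDiff_liftCone [Fact (0 < ε)] :
    ContMDiff 𝓘(ℂ, Fin 2 → ℂ) 𝓘(ℂ, Fin 2 → ℂ) ω (liftCone (ε := ε)) := by
  rw [contMDiff_V_iff]
  have h : ContMDiff 𝓘(ℂ, Fin 2 → ℂ) 𝓘(ℂ, C3) ω (Subtype.val : puncturedCone ε → C3) :=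
    isSmoothEmbedding_cone.contMDiff
  refine h.prodMk (CP.contMDiff_mk (f := fun u : puncturedCone ε => WithLp.ofLp u.1) ?_ _)
  exact (PiLp.contDiff_ofLp (𝕜 := ℂ) (n := ω)).contMDiff.comp h

/-- The blow-up map restricts to a biholomorphic map away from the exceptional divisor. -/
noncomputable def blowupDiffeomorph [h : Fact (0 < ε)] :
    complE h.out ≃ₘ^ω⟮𝓘(ℂ, Fin 2 → ℂ), 𝓘(ℂ, Fin 2 → ℂ)⟯ puncturedCone ε where
  toFun p := ⟨p.1.1.1, fst_mem_cone h.out p.1.2, p.2⟩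
  invFun u := ⟨liftCone u, u.2.2⟩
  left_inv p := by
    refine Subtype.ext (Subtype.ext (Prod.ext rfl ?_))
    exact (eq_mk_of_incident _ ((mem_V_iff_incident h.out).1 p.1.2).2.1).symm
  right_inv _ := rfl
  contMDiff_toFun := by
    rw [contMDiff_cone_iff]
    exact contMDiff_fst.comp (contMDiff_coe_V.comp contMDiff_subtype_val)
  contMDiff_invFun := by
    rw [ContMDiff.iff_comp_isImmersion (IsImmersion.of_opens (complE h.out : TopologicalSpace.Opens (V ε)))]
    exact ⟨contMDiff_liftCone.continuous.subtype_mk _, contMDiff_liftCone⟩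

/-! ### The exceptional divisor is a projective line -/

theorem contMDiff_conicPoint (i : Fin 2) :
    ContMDiff 𝓘(ℂ, ℂ) 𝓘(ℂ, Fin 2 → ℂ) ω (conicPoint i) := by
  refine (CP.contMDiff_ofAffine i.castSucc).comp (ContDiff.contMDiff (contDiff_pi.2 fun k => ?_))
  fin_cases k <;> simp <;> fun_prop

theorem veronese_ne_zero (w : CP 1) :
    (![w.rep 0 ^ 2, w.rep 1 ^ 2, w.rep 0 * w.rep 1] : Fin 3 → ℂ) ≠ 0 := fun h => by
  refine w.rep_nonzero (funext fun k => ?_)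
  fin_cases k
  · simpa using congrFun h 0
  · simpa using congrFun h 1

/-- The parametrization `(a : b) ↦ (a² : b² : a b)` of the conic. -/
noncomputable def veronese (w : CP 1) : CP 2 := Projectivization.mk ℂ _ (veronese_ne_zero w)

theorem veronese_rep_ne_zero_iff (w : CP 1) (i : Fin 2) :
    (veronese w).rep i.castSucc ≠ 0 ↔ w.rep i ≠ 0 := by
  rw [veronese, Ne, CP.rep_mk_eq_zero_iff]
  fin_cases i <;> simp

/-- In affine coordinates the Veronese map onto the conic is the identity `t ↦ t`, which makes it
and its inverse holomorphic. -/
theorem veronese_ofAffine (i : Fin 2) (a : Fin 1 → ℂ) :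
    veronese (CP.ofAffine i a) = conicPoint i (a 0) := by
  obtain ⟨c, hc, h⟩ := CP.rep_mk (i.insertNth (1 : ℂ) a) (CP.insertNth_ne_zero i a)
  change ∀ k, _ = c * (CP.ofAffine i a).rep k at h
  have h1 : 1 = c * (CP.ofAffine i a).rep i := by simpa using h i
  have h2 : a 0 = c * (CP.ofAffine i a).rep (i + 1) := by
    rw [← h]
    fin_cases i <;> rfl
  rw [veronese, conicPoint_eq_mk, Projectivization.mk_eq_mk_iff']
  -- With `r` the chosen representative, `1 = c r_i` and `t = c r_{i+1}`. Hence `r_i² (1, t², t)` is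
  -- the vector of quadratic monomials in `r`.
  refine ⟨((CP.ofAffine i a).rep i) ^ 2, funext fun k => ?_⟩
  revert k
  rw [forall_fin_three i]
  simp only [Pi.smul_apply, smul_eq_mul, lineVec_same, lineVec_other, lineVec_two, h2]
  set r := (CP.ofAffine i a).rep
  refine ⟨?_, ?_, ?_⟩
  · fin_cases i <;> simp
  · trans r (i + 1) ^ 2
    · linear_combination (-(r (i + 1) ^ 2 * (1 + c * r i))) * h1
    · fin_cases i <;> simp
  · trans r i * r (i + 1)
    · linear_combination (-(r i * r (i + 1))) * h1
    · fin_cases i <;> simp [mul_comm]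

theorem veronese_eq {w : CP 1} {i : Fin 2} (hi : w.rep i ≠ 0) :
    veronese w = conicPoint i (CP.affineCoord i w 0) := by
  rw [← veronese_ofAffine, CP.ofAffine_affineCoord hi]

theorem contMDiff_veronese : ContMDiff 𝓘(ℂ, Fin 1 → ℂ) 𝓘(ℂ, Fin 2 → ℂ) ω veronese := by
  intro w
  obtain ⟨i, hi⟩ := CP.exists_rep_ne_zero w
  have h := contMDiffAt_of_mem_maximalAtlas (CP.affineChart_mem_maximalAtlas i) (x := w) hi
  refine ((contMDiff_conicPoint i).contMDiffAt.comp w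
    ((contDiff_apply ℂ ℂ (0 : Fin 1)).contMDiff.contMDiffAt.comp w h)).congr_of_eventuallyEq ?_
  filter_upwards [(CP.isOpen_rep_ne_zero i).mem_nhds hi] with y hy
  exact veronese_eq hy

theorem veronese_mem_conic (w : CP 1) : veronese w ∈ conic :=
  (mk_mem_conic_iff _ _).2 (by simp; ring)

theorem veronese_injective : Function.Injective veronese := by
  intro w w' h
  obtain ⟨i, hi⟩ := CP.exists_rep_ne_zero w
  have hi' : w'.rep i ≠ 0 := by
    rw [← veronese_rep_ne_zero_iff, ← h, veronese_rep_ne_zero_iff]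
    exact hi
  rw [veronese_eq hi, veronese_eq hi'] at h
  have h1 := congrArg (fun v => CP.affineCoord i.castSucc v 1) h
  simp only [conicPoint, CP.affineCoord_ofAffine, Matrix.cons_val_one, Matrix.cons_val_fin_one] at h1
  rw [← CP.ofAffine_affineCoord hi, ← CP.ofAffine_affineCoord hi']
  congr 1
  funext k
  rw [Subsingleton.elim k 0]
  exact h1

/-- The parametrization of the exceptional divisor by the projective line. -/
noncomputable def lineToE [h : Fact (0 < ε)] (w : CP 1) : (E h.out : Set (V ε)) :=
  ⟨⟨(0, veronese w), (mem_V_iff_incident h.out).2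
    ⟨by simpa using h.out, fun j k => by simp, veronese_mem_conic w⟩⟩, rfl⟩

/-- This yields surjectivity and also an explicit local formula for the inverse, from which its
holomorphy is read off. -/
theorem lineToE_ofAffine [h : Fact (0 < ε)] (p : (E h.out : Set (V ε))) {i : Fin 2}
    (hi : p.1.1.2.rep i.castSucc ≠ 0) :
    lineToE (CP.ofAffine i fun _ => CP.affineCoord i.castSucc p.1.1.2 1) = p := by
  have hc := ((mem_V_iff_incident h.out).1 p.1.2).2.2
  refine Subtype.ext (Subtype.ext (Prod.ext (mem_E_iff.1 p.2).symm ?_))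
  change veronese _ = _
  rw [veronese_ofAffine, ← eq_conicPoint hc hi]

theorem lineToE_bijective [h : Fact (0 < ε)] : Function.Bijective (lineToE (ε := ε)) := by
  refine ⟨fun w w' hw => veronese_injective (congrArg (fun p => p.1.1.2) hw), fun p => ?_⟩
  obtain ⟨i, hi⟩ := exists_rep_ne_zero_of_V h.out p.1
  exact ⟨_, lineToE_ofAffine p hi⟩

/-- The exceptional divisor is biholomorphic to the projective line. -/
noncomputable def excDiffeomorph [h : Fact (0 < ε)] :
    (E h.out : Set (V ε)) ≃ₘ^ω⟮𝓘(ℂ, Fin 1 → ℂ), 𝓘(ℂ, Fin 1 → ℂ)⟯ CP 1 where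
  toEquiv := (Equiv.ofBijective _ lineToE_bijective).symm
  contMDiff_toFun := by
    intro p
    obtain ⟨i, hi⟩ := exists_rep_ne_zero_of_V h.out p.1
    have hs : ContMDiff 𝓘(ℂ, Fin 1 → ℂ) 𝓘(ℂ, Fin 2 → ℂ) ω
        fun q : (E h.out : Set (V ε)) => q.1.1.2 :=
      contMDiff_snd.comp (contMDiff_coe_V.comp isSmoothEmbedding_E.contMDiff)
    have ha := contMDiffAt_of_mem_maximalAtlas (CP.affineChart_mem_maximalAtlas i.castSucc)
      (x := p.1.1.2) hi
    have hl : ContDiff ℂ ω fun a : Fin 2 → ℂ => fun _ : Fin 1 => a 1 :=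
      contDiff_pi.2 fun _ => contDiff_apply ℂ ℂ 1
    refine ((CP.contMDiff_ofAffine i).contMDiffAt.comp p
      (hl.contMDiff.contMDiffAt.comp p (ha.comp p (hs p)))).congr_of_eventuallyEq ?_
    filter_upwards [hs.continuous.continuousAt.preimage_mem_nhds
      ((CP.isOpen_rep_ne_zero i.castSucc).mem_nhds hi)] with q hq
    exact (Equiv.symm_apply_eq _).2 (lineToE_ofAffine q hq).symm
  contMDiff_invFun := by
    change ContMDiff _ _ _ (lineToE (ε := ε))
    rw [contMDiff_E_iff, contMDiff_V_iff]
    exact contMDiff_const.prodMk contMDiff_veronese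

end Structures

end AOne

namespace AOne

section CanonicalForm

open Manifold

variable {ε : ℝ}

attribute [local instance] chartedSpaceProd isManifold_C3_prod chartedSpaceV isManifold_V
  chartedSpaceE isManifold_E chartedSpaceCone isManifold_cone

/-! ### The canonical form of `V_ε` -/

/-- A linear endomorphism of `ℂ²` with entries `a, b` in row `i` and `c, d` in the other row. -/
noncomputable def planeMap (i : Fin 2) (a b c d : ℂ) : (Fin 2 → ℂ) →L[ℂ] (Fin 2 → ℂ) :=
  ContinuousLinearMap.pi fun k =>
    if k = i then a • ContinuousLinearMap.proj i + b • ContinuousLinearMap.proj (i + 1)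
    else c • ContinuousLinearMap.proj i + d • ContinuousLinearMap.proj (i + 1)

theorem planeMap_apply (i : Fin 2) (a b c d : ℂ) (v : Fin 2 → ℂ) (k : Fin 2) :
    planeMap i a b c d v k =
      if k = i then a * v i + b * v (i + 1) else c * v i + d * v (i + 1) := by
  rw [planeMap, ContinuousLinearMap.pi_apply]
  split_ifs <;> simp

/-- Moving index `i` to the front permutes rows and columns alike, so the two signs cancel and the
value does not depend on `i`. -/
theorem det_planeMap (i : Fin 2) (a b c d : ℂ) :
    LinearMap.det (planeMap i a b c d : (Fin 2 → ℂ) →ₗ[ℂ] (Fin 2 → ℂ)) = a * d - b * c := by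
  rw [← LinearMap.det_toMatrix', Matrix.det_fin_two]
  simp only [LinearMap.toMatrix'_apply, ContinuousLinearMap.coe_coe, planeMap_apply]
  fin_cases i
  · simp
  · simp
    ring

/-- A map to `ℂ²` with given partial derivatives. -/
theorem hasFDerivAt_planeMap {i : Fin 2} {a b c d : ℂ} {f g : (Fin 2 → ℂ) → ℂ} {x : Fin 2 → ℂ}
    (hf : HasFDerivAt f (a • ContinuousLinearMap.proj i + b • ContinuousLinearMap.proj (i + 1) :
      (Fin 2 → ℂ) →L[ℂ] ℂ) x)
    (hg : HasFDerivAt g (c • ContinuousLinearMap.proj i + d • ContinuousLinearMap.proj (i + 1) :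
      (Fin 2 → ℂ) →L[ℂ] ℂ) x) :
    HasFDerivAt (fun y k => if k = i then f y else g y) (planeMap i a b c d) x := by
  refine hasFDerivAt_pi.2 fun k => ?_
  split_ifs
  · exact hf
  · exact hg

theorem hasFDerivAt_coord (i : Fin 2) (x : Fin 2 → ℂ) :
    HasFDerivAt (fun y : Fin 2 → ℂ => y i) (ContinuousLinearMap.proj i : (Fin 2 → ℂ) →L[ℂ] ℂ) x :=
  (ContinuousLinearMap.proj i : (Fin 2 → ℂ) →L[ℂ] ℂ).hasFDerivAt

theorem affineCoord_mk_one (i : Fin 2) (v : Fin 3 → ℂ) (hv : v ≠ 0) :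
    CP.affineCoord i.castSucc (Projectivization.mk ℂ v hv) 1 = v 2 / v i.castSucc := by
  rw [CP.affineCoord_mk]
  fin_cases i <;> rfl

theorem blowupChart_same (hε : 0 < ε) [Nonempty (V ε)] (i : Fin 2) (p : V ε) :
    (blowupGraph hε i).chart p i = p.1.1 i.castSucc :=
  blowupProj_same i (p.1.1, CP.affineCoord i.castSucc p.1.2)

theorem blowupChart_other (hε : 0 < ε) [Nonempty (V ε)] (i : Fin 2) (p : V ε) :
    (blowupGraph hε i).chart p (i + 1) = CP.affineCoord i.castSucc p.1.2 1 :=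
  blowupProj_other i (p.1.1, CP.affineCoord i.castSucc p.1.2)

theorem blowupChart_symm (hε : 0 < ε) [Nonempty (V ε)] (i : Fin 2) {x : Fin 2 → ℂ}
    (hx : ‖lineMap i x‖ < ε) :
    ((blowupGraph hε i).chart.symm x : C3 × CP 2) = (lineMap i x, conicPoint i (x (i + 1))) :=
  (blowupGraph hε i).coe_chart_symm hx

/-- The change of charts of the blow-up. -/
theorem blowupChart_transition (hε : 0 < ε) [Nonempty (V ε)] (i : Fin 2) {x : Fin 2 → ℂ}
    (hx : ‖lineMap i x‖ < ε) :
    (blowupGraph hε (i + 1)).chart ((blowupGraph hε i).chart.symm x) =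
      fun k => if k = i then (x (i + 1))⁻¹ else x i * x (i + 1) ^ 2 := by
  have hi : i + 1 + 1 = i := by fin_cases i <;> rfl
  refine fin_two_funext (i + 1) ?_ ?_
  · rw [blowupChart_same, blowupChart_symm hε i hx, if_neg (fin_two_add_one_ne i)]
    simp [lineMap_apply]
  · rw [blowupChart_other, blowupChart_symm hε i hx, hi, if_pos rfl, conicPoint_eq_mk,
      affineCoord_mk_one, lineVec_two, lineVec_other]
    -- At `t = 0` both `t / t²` and `t⁻¹` are `0` by convention, so the formula holds on the whole
    -- chart target, even off the overlap.
    by_cases h : x (i + 1) = 0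
    · simp [h]
    · field_simp

/-- The factor `t²` from the fibre of `O(-2)` cancels the `-t⁻²` from `t ↦ 1/t`. The sign comes out
as `+1` because the fibre coordinate sits in place `i` of the `i`-th chart, so the two coordinates
trade places between the charts. -/
theorem isUnimodularAtlas_V [h : Fact (0 < ε)] : IsUnimodularAtlas 2 (V ε) := by
  rintro ⟨_, i, rfl⟩ ⟨_, j, rfl⟩ p ⟨hpi, hpj⟩
  by_cases hij : j = i
  · subst hij
    have : (tangentBundleCore 𝓘(ℂ, Fin 2 → ℂ) (V ε)).coordChange
        ⟨(blowupGraph h.out j).chart, j, rfl⟩ ⟨(blowupGraph h.out j).chart, j, rfl⟩ p =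
        ContinuousLinearMap.id ℂ (Fin 2 → ℂ) := by
      ext1 v
      exact (tangentBundleCore 𝓘(ℂ, Fin 2 → ℂ) (V ε)).coordChange_self
        ⟨(blowupGraph h.out j).chart, j, rfl⟩ p hpj v
    exact (congrArg (fun L : (Fin 2 → ℂ) →L[ℂ] (Fin 2 → ℂ) =>
      LinearMap.det (L : (Fin 2 → ℂ) →ₗ[ℂ] (Fin 2 → ℂ))) this).trans (LinearMap.det_id)
  · obtain rfl : j = i + 1 := by
      revert hij
      fin_cases i <;> fin_cases j <;> simp
    set c := (blowupGraph h.out i).chart with hc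
    set x := c p with hx
    have hpi : p ∈ c.source := hpi
    have hxt : x ∈ c.target := c.map_source hpi
    have hcx : c.symm x = p := c.left_inv hpi
    -- On the overlap the homogeneous coordinate with index `i + 1`, which is `t²`, does not vanish.
    have hx0 : x (i + 1) ≠ 0 := by
      have h1 : p.1.2 = conicPoint i (x (i + 1)) := by
        rw [← hcx, hc, blowupChart_symm h.out i hxt]
      have h2 : p.1.2.rep (i + 1).castSucc ≠ 0 := (mem_blowupGraph_source h.out (i + 1)).1 hpj.1
      rw [h1, conicPoint_eq_mk, Ne, CP.rep_mk_eq_zero_iff, lineVec_other] at h2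
      exact fun h0 => h2 (by rw [h0]; ring)
    have hd : HasFDerivAt (fun (y : Fin 2 → ℂ) k =>
        if k = i then (y (i + 1))⁻¹ else y i * y (i + 1) ^ 2)
        (planeMap i 0 (-(x (i + 1) ^ 2)⁻¹) (x (i + 1) ^ 2) (2 * x i * x (i + 1))) x := by
      refine hasFDerivAt_planeMap ?_ ?_
      · refine ((hasDerivAt_inv hx0).comp_hasFDerivAt x (hasFDerivAt_coord (i + 1) x)).congr_fderiv ?_
        ext v
        simp
      · refine ((hasFDerivAt_coord i x).mul ((hasFDerivAt_coord (i + 1) x).pow 2)).congr_fderiv ?_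
        ext v
        simp
        ring
    have hev : ((blowupGraph h.out (i + 1)).chart.extend 𝓘(ℂ, Fin 2 → ℂ) ∘
        (c.extend 𝓘(ℂ, Fin 2 → ℂ)).symm) =ᶠ[𝓝 x] fun (y : Fin 2 → ℂ) k =>
        if k = i then (y (i + 1))⁻¹ else y i * y (i + 1) ^ 2 := by
      filter_upwards [c.open_target.mem_nhds hxt] with y hy
      exact blowupChart_transition h.out i hy
    have : (tangentBundleCore 𝓘(ℂ, Fin 2 → ℂ) (V ε)).coordChange
        ⟨c, i, rfl⟩ ⟨(blowupGraph h.out (i + 1)).chart, i + 1, rfl⟩ p =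
        planeMap i 0 (-(x (i + 1) ^ 2)⁻¹) (x (i + 1) ^ 2) (2 * x i * x (i + 1)) := by
      change fderivWithin ℂ ((blowupGraph h.out (i + 1)).chart.extend 𝓘(ℂ, Fin 2 → ℂ) ∘
        (c.extend 𝓘(ℂ, Fin 2 → ℂ)).symm) (Set.range 𝓘(ℂ, Fin 2 → ℂ)) x = _
      rw [ModelWithCorners.range_eq_univ, fderivWithin_univ, hev.fderiv_eq, hd.fderiv]
    refine (congrArg (fun L : (Fin 2 → ℂ) →L[ℂ] (Fin 2 → ℂ) =>
      LinearMap.det (L : (Fin 2 → ℂ) →ₗ[ℂ] (Fin 2 → ℂ))) this).trans ?_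
    refine (det_planeMap _ _ _ _ _).trans ?_
    field_simp
    ring

/-! ### The quotient map from the plane -/

theorem contMDiff_frakURestrict [Fact (0 < ε)] :
    ContMDiff 𝓘(ℂ, Fin 2 → ℂ) 𝓘(ℂ, Fin 2 → ℂ) ω (frakURestrict ε) := by
  rw [contMDiff_cone_iff]
  have h : ContDiff ℂ ω frakU := by
    rw [contDiff_euclidean]
    intro k
    fin_cases k <;> simp [frakU] <;> fun_prop
  exact h.contMDiff.comp contMDiff_subtype_val

/-- The lift of `𝔲` to the blow-up. -/
noncomputable def liftU (ε : ℝ) [Fact (0 < ε)] (z : puncturedDomain ε) : V ε :=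
  liftCone (frakURestrict ε z)

theorem contMDiff_liftU [Fact (0 < ε)] :
    ContMDiff 𝓘(ℂ, Fin 2 → ℂ) 𝓘(ℂ, Fin 2 → ℂ) ω (liftU ε) :=
  contMDiff_liftCone.comp contMDiff_frakURestrict

theorem frakU_castSucc (z : Fin 2 → ℂ) (i : Fin 2) : frakU z i.castSucc = z i ^ 2 := by
  fin_cases i <;> rfl

theorem frakU_two (z : Fin 2 → ℂ) (i : Fin 2) : frakU z 2 = z i * z (i + 1) := by
  fin_cases i
  · rfl
  · exact mul_comm _ _

theorem blowupChart_liftU [h : Fact (0 < ε)] (i : Fin 2) (z : puncturedDomain ε) :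
    (blowupGraph h.out i).chart (liftU ε z) =
      fun k => if k = i then z.1 i ^ 2 else z.1 (i + 1) / z.1 i := by
  refine fin_two_funext i ?_ ?_
  · rw [blowupChart_same, if_pos rfl]
    exact frakU_castSucc _ _
  · rw [blowupChart_other, if_neg (fin_two_add_one_ne i)]
    refine (affineCoord_mk_one i _ _).trans ?_
    change frakU z.1 2 / frakU z.1 i.castSucc = _
    rw [frakU_castSucc, frakU_two _ i]
    -- For `z_i = 0` both quotients are `0` by convention, so no restriction on `z` is needed.
    by_cases h0 : z.1 i = 0
    · simp [h0]
    · field_simp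

/-- The tangent space of `V_ε` at a point is read in the chart chosen there. The index `i` is
therefore the one selected at the lift of `z`, known only to satisfy `z_i ≠ 0`. -/
theorem mfderiv_liftU [h : Fact (0 < ε)] (z : puncturedDomain ε) :
    ∃ i : Fin 2, z.1 i ≠ 0 ∧ mfderiv 𝓘(ℂ, Fin 2 → ℂ) 𝓘(ℂ, Fin 2 → ℂ) (liftU ε) z =
      planeMap i (2 * z.1 i) 0 (-z.1 (i + 1) / z.1 i ^ 2) (z.1 i)⁻¹ := by
  set i := (blowupAtlas h.out).idx (liftU ε z) with hi
  have h0 : z.1 i ≠ 0 := by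
    have h1 : (liftU ε z).1.2.rep i.castSucc ≠ 0 := (mem_blowupGraph_source h.out i).1
      ((blowupAtlas h.out).mem_source (liftU ε z))
    have h2 : frakU z.1 i.castSucc ≠ 0 := fun h2 => h1 ((CP.rep_mk_eq_zero_iff _ _ _).2 h2)
    rw [frakU_castSucc] at h2
    exact fun h3 => h2 (by rw [h3]; ring)
  refine ⟨i, h0, ?_⟩
  have hm : MDifferentiableAt 𝓘(ℂ, Fin 2 → ℂ) 𝓘(ℂ, Fin 2 → ℂ) (liftU ε) z :=
    (contMDiff_liftU.contMDiffAt (x := z)).mdifferentiableAt (by simp)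
  have hd : HasFDerivAt (fun (y : Fin 2 → ℂ) k => if k = i then y i ^ 2 else y (i + 1) / y i)
      (planeMap i (2 * z.1 i) 0 (-z.1 (i + 1) / z.1 i ^ 2) (z.1 i)⁻¹) z.1 := by
    refine hasFDerivAt_planeMap ?_ ?_
    · refine ((hasFDerivAt_coord i z.1).pow 2).congr_fderiv ?_
      ext v
      simp
    · refine ((hasFDerivAt_coord (i + 1) z.1).mul
        ((hasDerivAt_inv h0).comp_hasFDerivAt z.1 (hasFDerivAt_coord i z.1))).congr_fderiv ?_
      ext v
      simp
      ring
  have hev : writtenInExtChartAt 𝓘(ℂ, Fin 2 → ℂ) 𝓘(ℂ, Fin 2 → ℂ) z (liftU ε) =ᶠ[𝓝 z.1]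
      fun (y : Fin 2 → ℂ) k => if k = i then y i ^ 2 else y (i + 1) / y i := by
    filter_upwards [(chartAt (Fin 2 → ℂ) z).open_target.mem_nhds (mem_chart_target _ z)] with y hy
    have hy' : ((chartAt (Fin 2 → ℂ) z).symm y).1 = y := (chartAt (Fin 2 → ℂ) z).right_inv hy
    change (blowupGraph h.out i).chart (liftU ε ((chartAt (Fin 2 → ℂ) z).symm y)) = _
    rw [blowupChart_liftU, hy']
  have key : ∀ F : (Fin 2 → ℂ) → (Fin 2 → ℂ),
      (F =ᶠ[𝓝 z.1] fun (y : Fin 2 → ℂ) k => if k = i then y i ^ 2 else y (i + 1) / y i) →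
      fderivWithin ℂ F (Set.range 𝓘(ℂ, Fin 2 → ℂ)) z.1 =
        planeMap i (2 * z.1 i) 0 (-z.1 (i + 1) / z.1 i ^ 2) (z.1 i)⁻¹ := fun F hF => by
    rw [ModelWithCorners.range_eq_univ, fderivWithin_univ, hF.fderiv_eq, hd.fderiv]
  exact hm.mfderiv.trans (key _ hev)

/-! ### Triviality of the canonical bundle and the pullback of the canonical form -/

theorem hasTrivialCanonicalBundle_V [Fact (0 < ε)] : HasTrivialCanonicalBundle 2 (V ε) :=
  isUnimodularAtlas_V.hasTrivialCanonicalBundle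

variable (ε) in
/-- The form `½ dx¹ ∧ dx²` in the charts of `V_ε`. -/
noncomputable def canonicalForm [Fact (0 < ε)] (p : V ε) : CanonicalFiber 2 (V ε) p :=
  ((1 / 2 : ℂ) • detForm 2 : (Fin 2 → ℂ) [⋀^Fin 2]→L[ℂ] ℂ)

theorem isHolomorphicTopForm_canonicalForm [Fact (0 < ε)] :
    IsHolomorphicTopForm (canonicalForm ε) :=
  isUnimodularAtlas_V.isHolomorphicTopForm_const (1 / 2)

theorem canonicalForm_ne_zero [Fact (0 < ε)] (p : V ε) : canonicalForm ε p ≠ 0 := fun h => by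
  have h1 := congrArg (fun η : (Fin 2 → ℂ) [⋀^Fin 2]→L[ℂ] ℂ => η ![![1, 0], ![0, 1]]) h
  have h2 : (1 / 2 : ℂ) * detForm 2 ![![1, 0], ![0, 1]] = 0 := h1
  simp [detForm_two] at h2

/-- The Jacobian determinant of the lift is `2 z_i · z_i⁻¹ = 2`, which the factor `1/2` in
`canonicalForm` cancels. -/
theorem detForm_planeMap (i : Fin 2) {z : Fin 2 → ℂ} (hz : z i ≠ 0) (a b : Fin 2 → ℂ) :
    (1 / 2 : ℂ) * detForm 2 ![planeMap i (2 * z i) 0 (-z (i + 1) / z i ^ 2) (z i)⁻¹ a,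
      planeMap i (2 * z i) 0 (-z (i + 1) / z i ^ 2) (z i)⁻¹ b] = a 0 * b 1 - a 1 * b 0 := by
  rw [detForm_two]
  simp only [Matrix.cons_val_zero, Matrix.cons_val_one, Matrix.cons_val_fin_one, planeMap_apply]
  revert hz
  fin_cases i <;> intro hz <;> simp at hz ⊢ <;> field_simp <;> ring

/-- The canonical form pulls back to `dz¹ ∧ dz²`. -/
theorem canonicalForm_mfderiv_liftU [Fact (0 < ε)] (z : puncturedDomain ε)
    (a b : TangentSpace 𝓘(ℂ, Fin 2 → ℂ) z) :
    (canonicalForm ε (liftU ε z)).eval ![mfderiv 𝓘(ℂ, Fin 2 → ℂ) 𝓘(ℂ, Fin 2 → ℂ) (liftU ε) z a,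
      mfderiv 𝓘(ℂ, Fin 2 → ℂ) 𝓘(ℂ, Fin 2 → ℂ) (liftU ε) z b] = a 0 * b 1 - a 1 * b 0 := by
  obtain ⟨i, h0, hi⟩ := mfderiv_liftU z
  rw [hi]
  exact detForm_planeMap i h0 a b

end CanonicalForm

end AOne

/-! ### The theorem -/

theorem mainTheorem6 (ε : ℝ) (hε : 0 < ε) :
    T2Space (AOne.V ε) ∧ SecondCountableTopology (AOne.V ε) ∧
    -- complex structures of dimension 2, 2, 1 on `V_ε`, on the punctured cone and on `E` ...
    ∃ (_ : ChartedSpace (Fin 2 → ℂ) (AOne.V ε))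
      (_ : IsManifold 𝓘(ℂ, Fin 2 → ℂ) ω (AOne.V ε))
      (_ : ChartedSpace (Fin 2 → ℂ) (AOne.puncturedCone ε))
      (_ : IsManifold 𝓘(ℂ, Fin 2 → ℂ) ω (AOne.puncturedCone ε))
      (_ : ChartedSpace (Fin 1 → ℂ) (AOne.E hε))
      (_ : IsManifold 𝓘(ℂ, Fin 1 → ℂ) ω (AOne.E hε)),
      -- ... which make them complex submanifolds of `ℂ³ × ℙ²`, of `ℂ³` and of `V_ε`
      Manifold.IsSmoothEmbedding 𝓘(ℂ, Fin 2 → ℂ) (𝓘(ℂ, AOne.C3).prod 𝓘(ℂ, Fin 2 → ℂ)) ω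
        (Subtype.val : AOne.V ε → AOne.C3 × CP 2) ∧
      Manifold.IsSmoothEmbedding 𝓘(ℂ, Fin 2 → ℂ) 𝓘(ℂ, AOne.C3) ω
        (Subtype.val : AOne.puncturedCone ε → AOne.C3) ∧
      Manifold.IsSmoothEmbedding 𝓘(ℂ, Fin 1 → ℂ) 𝓘(ℂ, Fin 2 → ℂ) ω
        (Subtype.val : AOne.E hε → AOne.V ε) ∧
      -- `E` is biholomorphic to `ℙ¹`
      Nonempty (AOne.E hε ≃ₘ^ω⟮𝓘(ℂ, Fin 1 → ℂ), 𝓘(ℂ, Fin 1 → ℂ)⟯ CP 1) ∧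
      -- the canonical bundle of `V_ε` is trivial
      HasTrivialCanonicalBundle 2 (AOne.V ε) ∧
      -- `σ` restricts to a biholomorphic map from `V_ε \ E` onto the punctured cone, ...
      ∃ Φ : AOne.complE hε ≃ₘ^ω⟮𝓘(ℂ, Fin 2 → ℂ), 𝓘(ℂ, Fin 2 → ℂ)⟯ AOne.puncturedCone ε,
        (∀ p, (Φ p : AOne.C3) = AOne.sigma hε p.1) ∧
        -- ... and `dz¹ ∧ dz²` extends to a nowhere vanishing holomorphic 2-form on `V_ε`
        ∃ η : ∀ p : AOne.V ε, CanonicalFiber 2 (AOne.V ε) p,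
          IsHolomorphicTopForm η ∧ (∀ p, η p ≠ 0) ∧
          ∀ (z : AOne.puncturedDomain ε) (a b : TangentSpace 𝓘(ℂ, Fin 2 → ℂ) z),
            (η (Φ.symm (AOne.frakURestrict ε z)).1).eval
              ![mfderiv 𝓘(ℂ, Fin 2 → ℂ) 𝓘(ℂ, Fin 2 → ℂ)
                  (fun w => (Φ.symm (AOne.frakURestrict ε w)).1) z a,
                mfderiv 𝓘(ℂ, Fin 2 → ℂ) 𝓘(ℂ, Fin 2 → ℂ)
                  (fun w => (Φ.symm (AOne.frakURestrict ε w)).1) z b] =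
            a 0 * b 1 - a 1 * b 0 := by
  have : Fact (0 < ε) := ⟨hε⟩
  refine ⟨inferInstance, inferInstance, AOne.chartedSpaceV, AOne.isManifold_V,
    AOne.chartedSpaceCone, AOne.isManifold_cone, AOne.chartedSpaceE, AOne.isManifold_E,
    AOne.isSmoothEmbedding_V, AOne.isSmoothEmbedding_cone, AOne.isSmoothEmbedding_E,
    ⟨AOne.excDiffeomorph⟩, AOne.hasTrivialCanonicalBundle_V,
    AOne.blowupDiffeomorph, fun _ => rfl, AOne.canonicalForm ε,
    AOne.isHolomorphicTopForm_canonicalForm, AOne.canonicalForm_ne_zero,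
    -- The inverse of `blowupDiffeomorph` is `liftCone`, so its composite with `frakURestrict` is
    -- `liftU` by definition.
    AOne.canonicalForm_mfderiv_liftU⟩
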